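/- Let $K,m$ be positive integers. For weights $\pi_k>0$, vectors $\mu_k\in\mathbb R^m$ and symmetric positive definite matrices $\Sigma_k\in\mathbb R^{m\times m}$ ($k\in[K]=\{1,\dots,K\}$) put $$q(x)=\sum_{k=1}^K\pi_k\,\mathcal N(x|\mu_k,\Sigma_k),\qquad \mathcal N(x|\mu,\Sigma)=\frac{1}{\sqrt{(2\pi)^m|\Sigma|}}\exp\Bigl(-\tfrac12\|x-\mu\|_\Sigma^2\Bigr),\qquad \|x\|_\Sigma^2=x\cdot(\Sigma^{-1}x),$$ $$H=-\int_{\mathbb R^m}q(x)\log q(x)\,dx,\qquad \widetilde H=-\sum_{k=1}^K\pi_k\int_{\mathbb R^m}\mathcal N(x|\mu_k,\Sigma_k)\log\bigl(\pi_k\,\mathcal N(x|\mu_k,\Sigma_k)\bigr)\,dx .$$ Let $\Gamma_k=\Sigma_k^{1/2}$ be the positive definite square root, with entries $\gamma_{k,pq}$, and let $$\alpha_{k,k'}=\frac{\|\mu_k-\mu_{k'}\|_{\Sigma_k}}{1+\|\Sigma_k^{-1/2}\Sigma_{k'}^{1/2}\|_{\rm op}},$$ where $\|\cdot\|_{\rm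 op}$ is the largest singular value. Let $\|\cdot\|_1$ be the entrywise $1$-norm of a matrix, $|\Sigma|$ the determinant of $\Sigma$, and $|\Gamma_{k,pq}|$ the (signed) determinant of the $(m-1)\times(m-1)$ matrix obtained from $\Gamma_k$ by deleting row $p$ and column $q$ (equal to $1$ if $m=1$). The partial derivatives below treat all $\pi_k$, all $\mu_{k,p}$ and all $m^2$ entries $\gamma_{k,pq}$ as independent variables: $H$ and $\widetilde H$ are given by the formulas above also when the weights do not sum to $1$, and when $\Gamma_k$ is replaced by a nearby, possibly non-symmetric, matrix $\Gamma$, the matrix $\Sigma_k$ is replaced by $\Gamma\Gamma^{\top}$. Suppose that $\sum_k\pi_k=1$. Then the following partial derivatives exist at $(\pi_k,\mu_k,\Gamma_k)_{k=1}^K$, and for all $k\in[K]$, $p,q\in[m]$ and $s\in(0,1)$: (i) $$\left|\frac{\partial (H-\widetilde H)}{\partial\mu_{k,p}}\right|\le\frac{2}{(1-s)^{\frac{m+2}{4}}}\sum_{k'\ne k}\sqrt{\pi_k\pi_{k'}}\,\bigl(\|\Gamma_{k'}^{-1}\|_1+\|\Gamma_k^{-1}\|_1\bigr)\exp\Bigl(-\frac{s\max(\alpha_{k,k'},\alpha_{k',k})^2}{4}\Bigr);$$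 (ii) $$\left|\frac{\partial (H-\widetilde H)}{\partial\gamma_{k,pq}}\right|\le\frac{6}{(1-s)^{\frac{m+4}{4}}}\sum_{k'\ne k}\sqrt{\pi_k\pi_{k'}}\,\bigl(2|\Gamma_k|^{-1}|\Gamma_{k,pq}|+\|\Gamma_k^{-1}\|_1+\|\Gamma_{k'}^{-1}\|_1\bigr)\exp\Bigl(-\frac{s\max(\alpha_{k,k'},\alpha_{k',k})^2}{4}\Bigr);$$ (iii) $$\left|\frac{\partial (H-\widetilde H)}{\partial\pi_k}\right|\le\frac{8}{(1-s)^{\frac m4}}\sum_{k'\ne k}\sqrt{\frac{\pi_{k'}}{\pi_k}}\,\exp\Bigl(-\frac{s\max(\alpha_{k,k'},\alpha_{k',k})^2}{4}\Bigr).$$ -/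

import Mathlib

open MeasureTheory
open scoped Matrix MatrixOrder

namespace GaussianMixture

variable {K m : ℕ}

/-- The norm `‖x‖_S = √(x · S⁻¹ x)` of a vector `x`, for a positive definite matrix `S`. -/
noncomputable def mnorm (S : Matrix (Fin m) (Fin m) ℝ) (x : Fin m → ℝ) : ℝ :=
  √(x ⬝ᵥ (S⁻¹ *ᵥ x))

/-- The density at `x` of the Gaussian distribution with mean `μ` and covariance matrix `S`. -/
noncomputable def gaussianDensity (μ : Fin m → ℝ) (S : Matrix (Fin m) (Fin m) ℝ)
    (x : Fin m → ℝ) : ℝ :=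
  1 / √((2 * Real.pi) ^ m * S.det) * Real.exp (-(1 / 2) * mnorm S (x - μ) ^ 2)

/-- The function `q(x) = ∑ₖ wₖ N(x | μₖ, Sₖ)`. -/
noncomputable def mixture (w : Fin K → ℝ) (μ : Fin K → Fin m → ℝ)
    (S : Fin K → Matrix (Fin m) (Fin m) ℝ) (x : Fin m → ℝ) : ℝ :=
  ∑ k, w k * gaussianDensity (μ k) (S k) x

/-- The entropy `H[q] = -∫ q log q`. -/
noncomputable def entropy (w : Fin K → ℝ) (μ : Fin K → Fin m → ℝ)
    (S : Fin K → Matrix (Fin m) (Fin m) ℝ) : ℝ :=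
  -∫ x, mixture w μ S x * Real.log (mixture w μ S x)

/-- The approximate entropy `H̃[q] = -∑ₖ wₖ ∫ N(x | μₖ, Sₖ) log (wₖ N(x | μₖ, Sₖ)) dx`. -/
noncomputable def approxEntropy (w : Fin K → ℝ) (μ : Fin K → Fin m → ℝ)
    (S : Fin K → Matrix (Fin m) (Fin m) ℝ) : ℝ :=
  -∑ k, w k * ∫ x, gaussianDensity (μ k) (S k) x *
    Real.log (w k * gaussianDensity (μ k) (S k) x)

/-- The error `H[q] - H̃[q]`, a function of independent variables `w`, `μ`, `S`
(the weights need not sum to one, so that its partial derivatives in `w` make sense). -/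
noncomputable def entropyError (w : Fin K → ℝ) (μ : Fin K → Fin m → ℝ)
    (S : Fin K → Matrix (Fin m) (Fin m) ℝ) : ℝ :=
  entropy w μ S - approxEntropy w μ S

/-- The operator norm of a matrix acting on Euclidean space (its largest singular value). -/
noncomputable def opNorm (A : Matrix (Fin m) (Fin m) ℝ) : ℝ :=
  ‖Matrix.toEuclideanCLM (n := Fin m) (𝕜 := ℝ) A‖

/-- The entrywise `1`-norm of a matrix. -/
def entryNorm (A : Matrix (Fin m) (Fin m) ℝ) : ℝ :=
  ∑ i, ∑ j, |A i j|

/-- The determinant of `A` with row `p` and column `q` deleted (with its sign). -/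
def minorDet : {m : ℕ} → Matrix (Fin m) (Fin m) ℝ → Fin m → Fin m → ℝ
  | 0, _, p, _ => p.elim0
  | _ + 1, A, p, q => (A.submatrix p.succAbove q.succAbove).det

/-- `Γ_k = Σ_k^{1/2}`, the positive semidefinite square root. -/
noncomputable def rootCov (S : Fin K → Matrix (Fin m) (Fin m) ℝ) (k : Fin K) :
    Matrix (Fin m) (Fin m) ℝ :=
  CFC.sqrt (S k)

/-- `α_{k,l} = ‖μ_k - μ_l‖_{Σ_k} / (1 + ‖Σ_k^{-1/2} Σ_l^{1/2}‖_op)`. -/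
noncomputable def alpha (μ : Fin K → Fin m → ℝ) (S : Fin K → Matrix (Fin m) (Fin m) ℝ)
    (k l : Fin K) : ℝ :=
  mnorm (S k) (μ k - μ l) / (1 + opNorm ((rootCov S k)⁻¹ * rootCov S l))

/-- The factor `exp (-s max(α_{k,l}, α_{l,k})² / 4)`. -/
noncomputable def decay (s : ℝ) (μ : Fin K → Fin m → ℝ)
    (S : Fin K → Matrix (Fin m) (Fin m) ℝ) (k l : Fin K) : ℝ :=
  Real.exp (-(s * max (alpha μ S k l) (alpha μ S l k) ^ 2 / 4))

/-- The vectors `μ` with the coordinate `μ_{k,p}` replaced by `t`. -/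
def setMean (μ : Fin K → Fin m → ℝ) (k : Fin K) (p : Fin m) (t : ℝ) : Fin K → Fin m → ℝ :=
  Function.update μ k (Function.update (μ k) p t)

/-- The matrix `A` with the single entry `A p q` replaced by `t`. -/
def setEntry (A : Matrix (Fin m) (Fin m) ℝ) (p q : Fin m) (t : ℝ) : Matrix (Fin m) (Fin m) ℝ :=
  A.updateRow p (Function.update (A p) q t)

/-- The covariance matrices `S` with `Σ_k` replaced by `G Gᵀ`, where `G` is `Γ_k = Σ_k^{1/2}` with
its single entry `γ_{k,pq}` replaced by `t`: the covariance of `G ε + μ_k` for standard Gaussian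
`ε`. At `t = γ_{k,pq}` it is `S` itself, and the `m²` entries are independent variables. -/
noncomputable def setRootEntry (S : Fin K → Matrix (Fin m) (Fin m) ℝ) (k : Fin K) (p q : Fin m)
    (t : ℝ) : Fin K → Matrix (Fin m) (Fin m) ℝ :=
  Function.update S k
    (setEntry (rootCov S k) p q t * (setEntry (rootCov S k) p q t)ᵀ)

end GaussianMixture

/-! Vary a single parameter of component `k`. Write g = w_k N_k = exp h and q = g + R, where R does
not depend on the parameter. Up to a constant, H − H̃ is −∫ q log q + ∫ g log g. Its derivative is
−∫ g h' (log q + 1) + ∫ g h' (log g + 1) = −∫ g h' log (q / g) (`hasDerivAt_entropyError`). Gaussian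
domination, locally uniform in the parameter, justifies differentiating under the integral.

Since log (1 + u) ≤ √u and √ is subadditive, g log (q / g) ≤ ∑_{l ≠ k} √(w_k w_l) √(N_k N_l)
(`mul_log_mixture_div_le`). The score h' is a polynomial of degree 0, 1 or 2 in the whitened
variable y = Γ_k⁻¹ (x − μ_k), for weights, means and root entries respectively. It remains to bound
moments of √(N_k N_l).

For these, every x is far from one of the two means: by the triangle inequality, α_{k,l} is at most
the larger of the two whitened distances (`alpha_le_max`). Hence 1 ≤ exp (−s α² / 4) · (exp (s
‖y_k‖² / 4) + exp (s ‖y_l‖² / 4)). Inserting this and applying Cauchy–Schwarz separates the two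
Gaussians. What is left are even moments of tilted Gaussians, which are explicit and produce the
powers of 1 − s (`integral_prod_pow_mul_sqrt_gaussianDensity_le`).

The minor in (ii) carries a sign and can be negative. Positive definiteness of Γ_k⁻¹ shows that the
entrywise norm then compensates for it (`minor_bound`). -/

namespace GaussianMixture

/-! ### Gaussian domination and differentiation under the integral sign -/

/-- Gaussian functions of the norm of `ℝᵐ` are integrable. -/
theorem integrable_exp_neg_mul_norm_sq {m : ℕ} {c : ℝ} (hc : 0 < c) :
    Integrable (fun x : Fin m → ℝ => Real.exp (-c * ‖x‖ ^ 2)) := by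
  have hc' : 0 < c / (m + 1) := by positivity
  have h1 : Integrable (fun x : Fin m → ℝ => ∏ i, Real.exp (-(c / (m + 1)) * x i ^ 2)) :=
    Integrable.fintype_prod (fun _ => integrable_exp_neg_mul_sq hc')
  refine h1.mono' (by fun_prop) (Filter.Eventually.of_forall fun x => ?_)
  rw [Real.norm_of_nonneg (Real.exp_pos _).le, ← Real.exp_sum, ← Finset.mul_sum]
  apply Real.exp_le_exp.2
  have h2 : ∑ i, x i ^ 2 ≤ (m + 1) * ‖x‖ ^ 2 := by
    calc ∑ i, x i ^ 2 ≤ ∑ _i : Fin m, ‖x‖ ^ 2 := by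
          refine Finset.sum_le_sum fun i _ => ?_
          rw [← sq_abs, ← Real.norm_eq_abs]
          exact pow_le_pow_left₀ (norm_nonneg _) (norm_le_pi_norm x i) 2
      _ = m * ‖x‖ ^ 2 := by simp
      _ ≤ _ := by nlinarith [sq_nonneg ‖x‖]
  have h3 : c / (m + 1) * ∑ i, x i ^ 2 ≤ c / (m + 1) * ((m + 1) * ‖x‖ ^ 2) :=
    mul_le_mul_of_nonneg_left h2 hc'.le
  have h4 : c / (m + 1) * ((m + 1) * ‖x‖ ^ 2) = c * ‖x‖ ^ 2 := by
    field_simp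
  linarith

/-- Half of the exponential decay absorbs the polynomial. The square is needed for domination: the
score and the logarithm of the mixture each grow like 1 + ‖x‖². -/
theorem integrable_one_add_norm_sq_sq_mul_exp {m : ℕ} {c : ℝ} (hc : 0 < c) :
    Integrable (fun x : Fin m → ℝ => (1 + ‖x‖ ^ 2) ^ 2 * Real.exp (-c * ‖x‖ ^ 2)) := by
  refine ((integrable_exp_neg_mul_norm_sq (m := m) (half_pos hc)).const_mul
    ((1 + 4 / c) ^ 2)).mono' (by fun_prop) (Filter.Eventually.of_forall fun x => ?_)
  rw [Real.norm_of_nonneg (by positivity)]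
  set u := ‖x‖ ^ 2
  have hu : 0 ≤ u := by positivity
  have h1 : 1 + u ≤ (1 + 4 / c) * Real.exp (c * u / 4) := by
    have h2 := Real.add_one_le_exp (c * u / 4)
    have h3 : (1 + 4 / c) * (c * u / 4 + 1) = 1 + u + (c * u / 4 + 4 / c) := by
      field_simp
      ring
    have h4 : (1 + 4 / c) * (c * u / 4 + 1) ≤ (1 + 4 / c) * Real.exp (c * u / 4) :=
      mul_le_mul_of_nonneg_left h2 (by positivity)
    have h5 : 0 ≤ c * u / 4 + 4 / c := by positivity
    linarith
  have h2 : (1 + u) ^ 2 ≤ (1 + 4 / c) ^ 2 * Real.exp (c * u / 2) := by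
    calc (1 + u) ^ 2 ≤ ((1 + 4 / c) * Real.exp (c * u / 4)) ^ 2 :=
          pow_le_pow_left₀ (by positivity) h1 2
      _ = _ := by
          rw [mul_pow, sq (Real.exp _), ← Real.exp_add]
          ring_nf
  calc (1 + u) ^ 2 * Real.exp (-c * u)
      ≤ (1 + 4 / c) ^ 2 * Real.exp (c * u / 2) * Real.exp (-c * u) :=
        mul_le_mul_of_nonneg_right h2 (Real.exp_pos _).le
    _ = _ := by
        rw [mul_assoc, ← Real.exp_add]
        ring_nf

/-- A continuously differentiable function is differentiable and bounded near a point, with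
bounded derivative. -/
theorem eventually_hasDerivAt_and_bounded {E : Type*} [NormedAddCommGroup E] [NormedSpace ℝ E]
    {f : ℝ → E} {t₀ : ℝ} (hf : ContDiffAt ℝ 1 f t₀) :
    ∃ M : ℝ, ∀ᶠ t in nhds t₀, HasDerivAt f (deriv f t) t ∧ ‖f t‖ ≤ M ∧ ‖deriv f t‖ ≤ M := by
  have h1 : ∀ᶠ t in nhds t₀, ContDiffAt ℝ 1 f t := hf.eventually (by simp)
  have h2 : ContinuousAt (fun t => ‖deriv f t‖) t₀ := by
    have h3 : ContinuousAt (fderiv ℝ f) t₀ := (hf.fderiv_right (m := 0) (by simp)).continuousAt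
    have h4 : (fun t => ‖deriv f t‖) = fun t => ‖fderiv ℝ f t‖ := by
      funext t
      rw [norm_deriv_eq_norm_fderiv]
    rw [h4]
    exact h3.norm
  have h3 : ContinuousAt (fun t => ‖f t‖) t₀ := hf.continuousAt.norm
  refine ⟨max (‖f t₀‖ + 1) (‖deriv f t₀‖ + 1), ?_⟩
  filter_upwards [h1, h2.eventually_lt_const (lt_add_one _), h3.eventually_lt_const (lt_add_one _)]
    with t ht1 ht2 ht3
  exact ⟨(ht1.differentiableAt (by simp)).hasDerivAt, ht3.le.trans (le_max_left _ _),
    ht2.le.trans (le_max_right _ _)⟩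

/-- A continuously differentiable family of nondegenerate quadratic functions
`ℓ t - ‖L t x - b t‖² / 2` has locally uniform bounds. -/
theorem eventually_logGaussian_bounds {V E : Type*} [NormedAddCommGroup V] [NormedSpace ℝ V]
    [NormedAddCommGroup E] [InnerProductSpace ℝ E] {ℓ : ℝ → ℝ} {L : ℝ → V →L[ℝ] E} {b : ℝ → E}
    {t₀ : ℝ} (hℓ : ContDiffAt ℝ 1 ℓ t₀) (hL : ContDiffAt ℝ 1 L t₀) (hb : ContDiffAt ℝ 1 b t₀)
    (hinj : ∃ C : ℝ, ∀ x, ‖x‖ ≤ C * ‖L t₀ x‖) :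
    ∃ A c : ℝ, 0 < c ∧ 1 ≤ A ∧ ∀ᶠ t in nhds t₀, ∀ x,
      HasDerivAt (fun t => ℓ t - ‖L t x - b t‖ ^ 2 / 2)
        (deriv ℓ t - inner ℝ (L t x - b t) (deriv L t x - deriv b t)) t ∧
      |ℓ t - ‖L t x - b t‖ ^ 2 / 2| ≤ A * (1 + ‖x‖ ^ 2) ∧
      |deriv ℓ t - inner ℝ (L t x - b t) (deriv L t x - deriv b t)| ≤ A * (1 + ‖x‖ ^ 2) ∧
      ℓ t - ‖L t x - b t‖ ^ 2 / 2 ≤ A - c * ‖x‖ ^ 2 := by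
  obtain ⟨M₁, h1⟩ := eventually_hasDerivAt_and_bounded hℓ
  obtain ⟨M₂, h2⟩ := eventually_hasDerivAt_and_bounded hL
  obtain ⟨M₃, h3⟩ := eventually_hasDerivAt_and_bounded hb
  obtain ⟨C₀, hC₀⟩ := hinj
  set M := max 1 (max M₁ (max M₂ M₃)) with hM
  set C := max 1 C₀ with hC
  have hM1 : 1 ≤ M := le_max_left _ _
  have hM₁ : M₁ ≤ M := (le_max_left _ _).trans (le_max_right _ _)
  have hM₂ : M₂ ≤ M := ((le_max_left _ _).trans (le_max_right _ _)).trans (le_max_right _ _)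
  have hM₃ : M₃ ≤ M := ((le_max_right _ _).trans (le_max_right _ _)).trans (le_max_right _ _)
  have hC1 : 1 ≤ C := le_max_left _ _
  have hCx : ∀ x, ‖x‖ ≤ C * ‖L t₀ x‖ := fun x =>
    (hC₀ x).trans (mul_le_mul_of_nonneg_right (le_max_right _ _) (norm_nonneg _))
  -- With this radius, replacing `L t₀` by `L t` costs at most ‖x‖ / 2 in the lower bound `hCx`, so
  -- coercivity survives near `t₀`.
  have hnear : ∀ᶠ t in nhds t₀, ‖L t - L t₀‖ < 1 / (2 * C) := by
    have h4 : ContinuousAt (fun t => ‖L t - L t₀‖) t₀ :=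
      (hL.continuousAt.sub continuousAt_const).norm
    exact h4.eventually_lt_const (by simp; positivity)
  -- The derivative bound needs M² from ℓ' and 2 M² from the inner product. The rate `c` comes from
  -- ‖x‖² ≤ 8 C² (‖L t x − b t‖² + M²), scaled to leave exactly half of the squared norm.
  refine ⟨3 * M ^ 2, 1 / (16 * C ^ 2), by positivity, by nlinarith, ?_⟩
  filter_upwards [h1, h2, h3, hnear] with t ⟨hd1, hb1, hb1'⟩ ⟨hd2, hb2, hb2'⟩ ⟨hd3, hb3, hb3'⟩ hn x
  have hy : HasDerivAt (fun t => L t x - b t) (deriv L t x - deriv b t) t := by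
    have := (hd2.clm_apply (hasDerivAt_const t x)).fun_sub hd3
    simpa using this
  have hyb : ‖L t x - b t‖ ≤ M * (‖x‖ + 1) := by
    calc ‖L t x - b t‖ ≤ ‖L t x‖ + ‖b t‖ := norm_sub_le _ _
      _ ≤ M * ‖x‖ + M := add_le_add
          (((L t).le_opNorm x).trans (mul_le_mul_of_nonneg_right (hb2.trans hM₂) (norm_nonneg _)))
          (hb3.trans hM₃)
      _ = _ := by ring
  have hyb' : ‖deriv L t x - deriv b t‖ ≤ M * (‖x‖ + 1) := by
    calc ‖deriv L t x - deriv b t‖ ≤ ‖deriv L t x‖ + ‖deriv b t‖ := norm_sub_le _ _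
      _ ≤ M * ‖x‖ + M := add_le_add
          (((deriv L t).le_opNorm x).trans
            (mul_le_mul_of_nonneg_right (hb2'.trans hM₂) (norm_nonneg _)))
          (hb3'.trans hM₃)
      _ = _ := by ring
  have hsq : (M * (‖x‖ + 1)) ^ 2 ≤ 2 * M ^ 2 * (1 + ‖x‖ ^ 2) := by
    nlinarith [mul_nonneg (sq_nonneg M) (sq_nonneg (‖x‖ - 1))]
  have hMM : M ≤ M ^ 2 * (1 + ‖x‖ ^ 2) := by
    nlinarith [mul_nonneg (sq_nonneg M) (sq_nonneg ‖x‖)]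
  have hy2 : ‖L t x - b t‖ ^ 2 ≤ (M * (‖x‖ + 1)) ^ 2 := pow_le_pow_left₀ (norm_nonneg _) hyb 2
  rw [Real.norm_eq_abs] at hb1 hb1'
  refine ⟨?_, ?_, ?_, ?_⟩
  · have := hd1.fun_sub (hy.norm_sq.div_const 2)
    simpa using this
  · refine (abs_sub _ _).trans ?_
    rw [abs_of_nonneg (by positivity : 0 ≤ ‖L t x - b t‖ ^ 2 / 2)]
    nlinarith [sq_nonneg (‖L t x - b t‖)]
  · refine (abs_sub _ _).trans ?_
    have h5 : |inner ℝ (L t x - b t) (deriv L t x - deriv b t)| ≤ (M * (‖x‖ + 1)) ^ 2 := by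
      refine (abs_real_inner_le_norm _ _).trans ?_
      rw [sq]
      exact mul_le_mul hyb hyb' (norm_nonneg _) (by positivity)
    linarith
  · have h5 : ‖x‖ ≤ 2 * C * (‖L t x - b t‖ + M) := by
      have h6 : ‖L t₀ x‖ ≤ ‖L t x - b t‖ + ‖b t‖ + ‖L t - L t₀‖ * ‖x‖ := by
        have h7 : L t₀ x = (L t x - b t) + b t - (L t - L t₀) x := by simp
        calc ‖L t₀ x‖ = ‖(L t x - b t) + b t - (L t - L t₀) x‖ := by rw [← h7]
          _ ≤ ‖(L t x - b t) + b t‖ + ‖(L t - L t₀) x‖ := norm_sub_le _ _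
          _ ≤ _ := add_le_add (norm_add_le _ _) ((L t - L t₀).le_opNorm x)
      have h8 : ‖L t - L t₀‖ * ‖x‖ ≤ 1 / (2 * C) * ‖x‖ :=
        mul_le_mul_of_nonneg_right hn.le (norm_nonneg _)
      have h9 : C * ‖L t₀ x‖ ≤ C * (‖L t x - b t‖ + M + 1 / (2 * C) * ‖x‖) :=
        mul_le_mul_of_nonneg_left (by linarith) (by linarith)
      have h10 : C * (‖L t x - b t‖ + M + 1 / (2 * C) * ‖x‖)
          = C * (‖L t x - b t‖ + M) + ‖x‖ / 2 := by
        field_simp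
      have := hCx x
      linarith
    have h6 : ‖x‖ ^ 2 ≤ (2 * C * (‖L t x - b t‖ + M)) ^ 2 := pow_le_pow_left₀ (norm_nonneg _) h5 2
    have h7 : (2 * C * (‖L t x - b t‖ + M)) ^ 2 ≤ 8 * C ^ 2 * (‖L t x - b t‖ ^ 2 + M ^ 2) := by
      nlinarith [mul_nonneg (sq_nonneg C) (sq_nonneg (‖L t x - b t‖ - M))]
    have h8 : 1 / (16 * C ^ 2) * ‖x‖ ^ 2 ≤ 1 / (16 * C ^ 2) * (8 * C ^ 2 * (‖L t x - b t‖ ^ 2 + M ^ 2)) :=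
      mul_le_mul_of_nonneg_left (h6.trans h7) (by positivity)
    have h9 : 1 / (16 * C ^ 2) * (8 * C ^ 2 * (‖L t x - b t‖ ^ 2 + M ^ 2))
        = (‖L t x - b t‖ ^ 2 + M ^ 2) / 2 := by
      field_simp
      norm_num
    have := le_abs_self (ℓ t)
    nlinarith

/-- Differentiation under the integral sign for `∫ (eʰ + R) log (eʰ + R)`. -/
theorem hasDerivAt_integral_add_mul_log {m : ℕ} {h h' : ℝ → (Fin m → ℝ) → ℝ} {t₀ A c : ℝ}
    (hc : 0 < c) (hA : 1 ≤ A) (hcont : ∀ t, Continuous (h t)) (hcont' : ∀ t, Continuous (h' t))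
    (hbd : ∀ᶠ t in nhds t₀, ∀ x, HasDerivAt (fun t => h t x) (h' t x) t ∧
      |h t x| ≤ A * (1 + ‖x‖ ^ 2) ∧ |h' t x| ≤ A * (1 + ‖x‖ ^ 2) ∧ h t x ≤ A - c * ‖x‖ ^ 2)
    {R : (Fin m → ℝ) → ℝ} (hRc : Continuous R) (hR0 : ∀ x, 0 ≤ R x)
    (hR : ∃ B d : ℝ, 0 < d ∧ ∀ x, R x ≤ B * Real.exp (-d * ‖x‖ ^ 2)) :
    Integrable (fun x => Real.exp (h t₀ x) * h' t₀ x * (Real.log (Real.exp (h t₀ x) + R x) + 1)) ∧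
    HasDerivAt
      (fun t => ∫ x, (Real.exp (h t x) + R x) * Real.log (Real.exp (h t x) + R x))
      (∫ x, Real.exp (h t₀ x) * h' t₀ x * (Real.log (Real.exp (h t₀ x) + R x) + 1)) t₀ := by
  obtain ⟨B, d, hd, hR⟩ := hR
  have hB0 : 0 ≤ B := by
    have h1 := (hR0 0).trans (hR 0)
    simpa using h1
  have hpos : ∀ t x, 0 < Real.exp (h t x) + R x := fun t x =>
    add_pos_of_pos_of_nonneg (Real.exp_pos _) (hR0 x)
  -- The term `A` serves the lower bound log (eʰ + R) ≥ h; the other two serve the upper bound log z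
  -- ≤ z − 1 with z ≤ exp A + B.
  set D := A + Real.exp A + B with hD
  have hD1 : 1 ≤ D := by
    have := Real.exp_pos A
    linarith
  have hg : ∀ t x, h t x ≤ A - c * ‖x‖ ^ 2 →
      Real.exp (h t x) ≤ Real.exp A * Real.exp (-c * ‖x‖ ^ 2) := by
    intro t x hx
    rw [← Real.exp_add]
    exact Real.exp_le_exp.2 (by linarith)
  have hlog : ∀ t x, |h t x| ≤ A * (1 + ‖x‖ ^ 2) → h t x ≤ A - c * ‖x‖ ^ 2 →
      |Real.log (Real.exp (h t x) + R x)| ≤ D * (1 + ‖x‖ ^ 2) := by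
    intro t x hx1 hx2
    have hx0 : 0 ≤ ‖x‖ ^ 2 := by positivity
    have hA' : 0 < Real.exp A := Real.exp_pos A
    rw [abs_le]
    constructor
    · have h1 : h t x ≤ Real.log (Real.exp (h t x) + R x) := by
        rw [Real.le_log_iff_exp_le (hpos t x)]
        linarith [hR0 x]
      have h2 := (abs_le.1 hx1).1
      have h3 : A * (1 + ‖x‖ ^ 2) ≤ D * (1 + ‖x‖ ^ 2) :=
        mul_le_mul_of_nonneg_right (by linarith) (by linarith)
      linarith
    · have h1 := Real.log_le_sub_one_of_pos (hpos t x)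
      have h2 : Real.exp (h t x) ≤ Real.exp A := Real.exp_le_exp.2 (by nlinarith)
      have h3 : R x ≤ B := by
        refine (hR x).trans ?_
        have : Real.exp (-d * ‖x‖ ^ 2) ≤ 1 := Real.exp_le_one_iff.2 (by nlinarith)
        nlinarith
      nlinarith
  have hmeas : ∀ t, Continuous (fun x => Real.log (Real.exp (h t x) + R x)) := fun t =>
    Continuous.log (by fun_prop) (fun x => (hpos t x).ne')
  obtain ⟨hb1, hb2, hb3, hb4⟩ : (∀ x, HasDerivAt (fun t => h t x) (h' t₀ x) t₀) ∧
      (∀ x, |h t₀ x| ≤ A * (1 + ‖x‖ ^ 2)) ∧ (∀ x, |h' t₀ x| ≤ A * (1 + ‖x‖ ^ 2)) ∧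
      ∀ x, h t₀ x ≤ A - c * ‖x‖ ^ 2 := by
    have := hbd.self_of_nhds
    exact ⟨fun x => (this x).1, fun x => (this x).2.1, fun x => (this x).2.2.1,
      fun x => (this x).2.2.2⟩
  refine hasDerivAt_integral_of_dominated_loc_of_deriv_le
    (F := fun t x => (Real.exp (h t x) + R x) * Real.log (Real.exp (h t x) + R x))
    (F' := fun t x => Real.exp (h t x) * h' t x * (Real.log (Real.exp (h t x) + R x) + 1))
    (bound := fun x => Real.exp A * A * (D + 1) *
      ((1 + ‖x‖ ^ 2) ^ 2 * Real.exp (-c * ‖x‖ ^ 2))) hbd ?_ ?_ ?_ ?_ ?_ ?_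
  · refine Filter.Eventually.of_forall fun t => Continuous.aestronglyMeasurable ?_
    have := hmeas t
    fun_prop
  · have hint1 := (integrable_one_add_norm_sq_sq_mul_exp (m := m) hc).const_mul (Real.exp A * D)
    have hint2 := (integrable_one_add_norm_sq_sq_mul_exp (m := m) hd).const_mul (B * D)
    refine (hint1.add hint2).mono' ?_ (Filter.Eventually.of_forall fun x => ?_)
    · refine Continuous.aestronglyMeasurable ?_
      have := hmeas t₀
      fun_prop
    · simp only [Pi.add_apply]
      rw [norm_mul, Real.norm_of_nonneg (hpos t₀ x).le, Real.norm_eq_abs]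
      have h1 := hlog t₀ x (hb2 x) (hb4 x)
      have h2 := hg t₀ x (hb4 x)
      have h3 : 1 + ‖x‖ ^ 2 ≤ (1 + ‖x‖ ^ 2) ^ 2 := by nlinarith [sq_nonneg ‖x‖]
      calc (Real.exp (h t₀ x) + R x) * |Real.log (Real.exp (h t₀ x) + R x)|
          ≤ (Real.exp A * Real.exp (-c * ‖x‖ ^ 2) + B * Real.exp (-d * ‖x‖ ^ 2)) *
            (D * (1 + ‖x‖ ^ 2) ^ 2) := by
            refine mul_le_mul (add_le_add h2 (hR x)) (h1.trans ?_) (abs_nonneg _) (by positivity)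
            exact mul_le_mul_of_nonneg_left h3 (by linarith)
        _ = _ := by ring
  · refine Continuous.aestronglyMeasurable ?_
    have := hmeas t₀
    fun_prop
  · refine Filter.Eventually.of_forall fun x t ht => ?_
    obtain ⟨-, ht2, ht3, ht4⟩ := ht x
    have h1 := hlog t x ht2 ht4
    have h2 := hg t x ht4
    rw [norm_mul, norm_mul, Real.norm_of_nonneg (Real.exp_pos _).le, Real.norm_eq_abs,
      Real.norm_eq_abs]
    have h3 : |Real.log (Real.exp (h t x) + R x) + 1| ≤ (D + 1) * (1 + ‖x‖ ^ 2) := by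
      refine (abs_add_le _ _).trans ?_
      rw [abs_one]
      nlinarith [sq_nonneg ‖x‖]
    calc Real.exp (h t x) * |h' t x| * |Real.log (Real.exp (h t x) + R x) + 1|
        ≤ Real.exp A * Real.exp (-c * ‖x‖ ^ 2) * (A * (1 + ‖x‖ ^ 2)) *
          ((D + 1) * (1 + ‖x‖ ^ 2)) := by
          refine mul_le_mul (mul_le_mul h2 ht3 (abs_nonneg _) (by positivity)) h3 (abs_nonneg _)
            (by positivity)
      _ = _ := by ring
  · exact (integrable_one_add_norm_sq_sq_mul_exp hc).const_mul _
  · refine Filter.Eventually.of_forall fun x t ht => ?_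
    have h1 : HasDerivAt (fun t => Real.exp (h t x) + R x) (Real.exp (h t x) * h' t x) t :=
      ((ht x).1.exp).add_const _
    have h2 := h1.mul (h1.log (hpos t x).ne')
    refine h2.congr_deriv ?_
    have := (hpos t x).ne'
    field_simp

/-! ### Square roots of covariances and whitened coordinates -/

section Root

variable {m : ℕ} {S : Matrix (Fin m) (Fin m) ℝ}

theorem sqrt_mul_sqrt_of_posDef (hS : S.PosDef) : CFC.sqrt S * CFC.sqrt S = S :=
  CFC.sqrt_mul_sqrt_self S (Matrix.nonneg_iff_posSemidef.2 hS.posSemidef)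

theorem posDef_sqrt (hS : S.PosDef) : (CFC.sqrt S).PosDef := by
  have h1 : (CFC.sqrt S).PosSemidef := Matrix.nonneg_iff_posSemidef.1 (CFC.sqrt_nonneg S)
  refine (Matrix.PosSemidef.posDef_iff_det_ne_zero h1).2 fun h => ?_
  have h2 := hS.det_pos
  rw [← sqrt_mul_sqrt_of_posDef hS, Matrix.det_mul, h] at h2
  simp at h2

theorem transpose_sqrt (hS : S.PosDef) : (CFC.sqrt S)ᵀ = CFC.sqrt S := by
  have := (posDef_sqrt hS).isHermitian
  simpa [Matrix.IsHermitian] using this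

theorem sqrt_mul_transpose (hS : S.PosDef) : CFC.sqrt S * (CFC.sqrt S)ᵀ = S := by
  rw [transpose_sqrt hS, sqrt_mul_sqrt_of_posDef hS]

end Root

section Whiten

variable {m : ℕ}

/-- Multiplication of vectors by `A`, with values in Euclidean space. -/
noncomputable def mulVecEuclidean (A : Matrix (Fin m) (Fin m) ℝ) :
    (Fin m → ℝ) →L[ℝ] EuclideanSpace ℝ (Fin m) :=
  LinearMap.toContinuousLinearMap
    ((WithLp.linearEquiv 2 ℝ (Fin m → ℝ)).symm.toLinearMap ∘ₗ A.mulVecLin)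

theorem mulVecEuclidean_apply (A : Matrix (Fin m) (Fin m) ℝ) (x : Fin m → ℝ) :
    mulVecEuclidean A x = WithLp.toLp 2 (A *ᵥ x) := rfl

theorem norm_sq_mulVecEuclidean (A : Matrix (Fin m) (Fin m) ℝ) (x : Fin m → ℝ) :
    ‖mulVecEuclidean A x‖ ^ 2 = (A *ᵥ x) ⬝ᵥ (A *ᵥ x) := by
  rw [EuclideanSpace.norm_sq_eq]
  simp [mulVecEuclidean_apply, dotProduct, sq]

theorem exists_norm_le_mulVecEuclidean {A : Matrix (Fin m) (Fin m) ℝ} (hA : A.det ≠ 0) :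
    ∃ C : ℝ, ∀ x, ‖x‖ ≤ C * ‖mulVecEuclidean A x‖ := by
  have hker : LinearMap.ker (mulVecEuclidean A : (Fin m → ℝ) →ₗ[ℝ] EuclideanSpace ℝ (Fin m)) = ⊥ := by
    rw [LinearMap.ker_eq_bot]
    intro x y hxy
    have h1 : A *ᵥ x = A *ᵥ y := congrArg WithLp.ofLp hxy
    exact Matrix.mulVec_injective_iff_isUnit.2
      ((Matrix.isUnit_iff_isUnit_det A).2 (isUnit_iff_ne_zero.2 hA)) h1
  obtain ⟨C, -, hC⟩ := LinearMap.exists_antilipschitzWith _ hker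
  refine ⟨C, fun x => ?_⟩
  have := hC.le_mul_dist x 0
  simpa using this

theorem mnorm_mul_transpose {G : Matrix (Fin m) (Fin m) ℝ} (x : Fin m → ℝ) :
    mnorm (G * Gᵀ) x = ‖mulVecEuclidean G⁻¹ x‖ := by
  rw [mnorm, ← Real.sqrt_sq (norm_nonneg (mulVecEuclidean G⁻¹ x)), norm_sq_mulVecEuclidean,
    Matrix.mul_inv_rev, ← Matrix.transpose_nonsing_inv, ← Matrix.mulVec_mulVec,
    Matrix.dotProduct_mulVec, Matrix.vecMul_transpose]

/-- Stated for any invertible `G`, since a perturbed root need not be symmetric. A negative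
determinant is harmless because `Real.log` depends only on the absolute value. -/
theorem gaussianDensity_mul_transpose {G : Matrix (Fin m) (Fin m) ℝ} (hG : G.det ≠ 0)
    (μ x : Fin m → ℝ) :
    gaussianDensity μ (G * Gᵀ) x = Real.exp (-((m : ℝ) / 2 * Real.log (2 * Real.pi)) -
      Real.log G.det - ‖mulVecEuclidean G⁻¹ (x - μ)‖ ^ 2 / 2) := by
  have h1 : 1 / √((2 * Real.pi) ^ m * (G * Gᵀ).det) =
      Real.exp (-((m : ℝ) / 2 * Real.log (2 * Real.pi)) - Real.log G.det) := by
    have h2 : 0 < (2 * Real.pi) ^ m * (G * Gᵀ).det := by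
      rw [Matrix.det_mul, Matrix.det_transpose]
      have := mul_self_pos.2 hG
      positivity
    rw [one_div, ← Real.exp_log (Real.sqrt_pos.2 h2), ← Real.exp_neg, Real.log_sqrt h2.le,
      Matrix.det_mul, Matrix.det_transpose, Real.log_mul (by positivity) (by positivity),
      Real.log_pow, Real.log_mul hG hG]
    congr 1
    ring
  rw [gaussianDensity, h1, mnorm_mul_transpose, ← Real.exp_add]
  congr 1
  ring

theorem gaussianDensity_eq {S : Matrix (Fin m) (Fin m) ℝ} (hS : S.PosDef) (μ x : Fin m → ℝ) :
    gaussianDensity μ S x = Real.exp (-((m : ℝ) / 2 * Real.log (2 * Real.pi)) -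
      Real.log (CFC.sqrt S).det - ‖mulVecEuclidean (CFC.sqrt S)⁻¹ (x - μ)‖ ^ 2 / 2) := by
  conv_lhs => rw [← sqrt_mul_transpose hS]
  exact gaussianDensity_mul_transpose (posDef_sqrt hS).det_pos.ne' μ x

theorem gaussianDensity_pos {S : Matrix (Fin m) (Fin m) ℝ} (hS : S.PosDef) (μ x : Fin m → ℝ) :
    0 < gaussianDensity μ S x := by
  rw [gaussianDensity_eq hS]
  exact Real.exp_pos _

theorem continuous_gaussianDensity {S : Matrix (Fin m) (Fin m) ℝ} (hS : S.PosDef)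
    (μ : Fin m → ℝ) : Continuous (gaussianDensity μ S) := by
  have h : gaussianDensity μ S = _ := funext (gaussianDensity_eq hS μ)
  rw [h]
  fun_prop

theorem exists_gaussianDensity_le {S : Matrix (Fin m) (Fin m) ℝ} (hS : S.PosDef)
    (μ : Fin m → ℝ) :
    ∃ B d : ℝ, 0 < d ∧ ∀ x, gaussianDensity μ S x ≤ B * Real.exp (-d * ‖x‖ ^ 2) := by
  have hdet : (CFC.sqrt S)⁻¹.det ≠ 0 := by
    simpa [Matrix.det_nonsing_inv] using (posDef_sqrt hS).det_pos.ne'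
  -- A constant family: only the pointwise quadratic upper bound is wanted.
  obtain ⟨A, c, hc, -, h⟩ := eventually_logGaussian_bounds (t₀ := 0)
    (ℓ := fun _ => -((m : ℝ) / 2 * Real.log (2 * Real.pi)) - Real.log (CFC.sqrt S).det)
    (L := fun _ => mulVecEuclidean (CFC.sqrt S)⁻¹)
    (b := fun _ => mulVecEuclidean (CFC.sqrt S)⁻¹ μ)
    contDiffAt_const contDiffAt_const contDiffAt_const (exists_norm_le_mulVecEuclidean hdet)
  refine ⟨Real.exp A, c, hc, fun x => ?_⟩
  have h1 := (h.self_of_nhds x).2.2.2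
  rw [gaussianDensity_eq hS, ← Real.exp_add, map_sub]
  exact Real.exp_le_exp.2 (by linarith)

end Whiten

/-! ### The derivative of the entropy error -/

/-- The derivative of the error along a family in which only the `k`-th component varies, with
`wₖ N(x | μₖ, Sₖ) = exp (ℓ t - ‖L t x - b t‖² / 2)`. -/
theorem hasDerivAt_entropyError {K m : ℕ} {w : Fin K → ℝ} {μ : Fin K → Fin m → ℝ}
    {S : Fin K → Matrix (Fin m) (Fin m) ℝ} (hw : ∀ k, 0 < w k) (hS : ∀ k, (S k).PosDef)
    (k : Fin K) {wt : ℝ → ℝ} {μt : ℝ → Fin m → ℝ} {St : ℝ → Matrix (Fin m) (Fin m) ℝ}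
    {E : Type*} [NormedAddCommGroup E] [InnerProductSpace ℝ E]
    {ℓ : ℝ → ℝ} {L : ℝ → (Fin m → ℝ) →L[ℝ] E} {b : ℝ → E} {t₀ : ℝ}
    (hℓ : ContDiffAt ℝ 1 ℓ t₀) (hL : ContDiffAt ℝ 1 L t₀) (hb : ContDiffAt ℝ 1 b t₀)
    (hinj : ∃ C : ℝ, ∀ x, ‖x‖ ≤ C * ‖L t₀ x‖)
    (hg : ∀ᶠ t in nhds t₀, ∀ x, wt t * gaussianDensity (μt t) (St t) x =
      Real.exp (ℓ t - ‖L t x - b t‖ ^ 2 / 2))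
    (hw₀ : wt t₀ = w k) (hμ₀ : μt t₀ = μ k) (hS₀ : St t₀ = S k) :
    HasDerivAt (fun t => entropyError (Function.update w k (wt t)) (Function.update μ k (μt t))
      (Function.update S k (St t)))
      (-∫ x, w k * gaussianDensity (μ k) (S k) x *
        (deriv ℓ t₀ - inner ℝ (L t₀ x - b t₀) (deriv L t₀ x - deriv b t₀)) *
        Real.log (mixture w μ S x / (w k * gaussianDensity (μ k) (S k) x))) t₀ := by
  set R : (Fin m → ℝ) → ℝ := fun x =>
    ∑ l ∈ Finset.univ.erase k, w l * gaussianDensity (μ l) (S l) x with hRdef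
  have hRc : Continuous R := by
    refine continuous_finsetSum _ fun l _ => ?_
    have := continuous_gaussianDensity (hS l) (μ l)
    fun_prop
  have hR0 : ∀ x, 0 ≤ R x := fun x => Finset.sum_nonneg fun l _ =>
    (mul_pos (hw l) (gaussianDensity_pos (hS l) _ _)).le
  have hRb : ∃ B d : ℝ, 0 < d ∧ ∀ x, R x ≤ B * Real.exp (-d * ‖x‖ ^ 2) := by
    choose B d hd hBd using fun l => exists_gaussianDensity_le (hS l) (μ l)
    have hB0 : ∀ l, 0 ≤ B l := fun l => by
      have h1 := (gaussianDensity_pos (hS l) (μ l) 0).le.trans (hBd l 0)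
      simpa using h1
    -- The slowest of the finitely many decay rates serves all components.
    obtain ⟨d₀, hd₀, hle⟩ : ∃ d₀ : ℝ, 0 < d₀ ∧ ∀ l, d₀ ≤ d l := by
      obtain ⟨j, -, hj⟩ := Finset.exists_min_image Finset.univ d ⟨k, Finset.mem_univ k⟩
      exact ⟨d j, hd j, fun l => hj l (Finset.mem_univ l)⟩
    refine ⟨∑ l ∈ Finset.univ.erase k, w l * B l, d₀, hd₀, fun x => ?_⟩
    rw [Finset.sum_mul]
    refine Finset.sum_le_sum fun l _ => ?_
    rw [mul_assoc]
    refine mul_le_mul_of_nonneg_left ((hBd l x).trans ?_) (hw l).le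
    refine mul_le_mul_of_nonneg_left (Real.exp_le_exp.2 ?_) (hB0 l)
    nlinarith [mul_le_mul_of_nonneg_right (hle l) (sq_nonneg ‖x‖)]
  obtain ⟨A, c, hc, hA, hbd⟩ := eventually_logGaussian_bounds hℓ hL hb hinj
  set h : ℝ → (Fin m → ℝ) → ℝ := fun t x => ℓ t - ‖L t x - b t‖ ^ 2 / 2 with hh
  set h' : ℝ → (Fin m → ℝ) → ℝ := fun t x =>
    deriv ℓ t - inner ℝ (L t x - b t) (deriv L t x - deriv b t) with hh'
  have hcont : ∀ t, Continuous (h t) := fun t => by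
    simp only [hh]
    fun_prop
  have hcont' : ∀ t, Continuous (h' t) := fun t => by
    simp only [hh']
    fun_prop
  obtain ⟨hi1, hd1⟩ := hasDerivAt_integral_add_mul_log hc hA hcont hcont' hbd hRc hR0 hRb
  -- The case R = 0 handles the term ∫ g log g coming from H̃.
  obtain ⟨hi2, hd2⟩ := hasDerivAt_integral_add_mul_log (R := fun _ => 0) hc hA hcont hcont' hbd
    continuous_const (fun _ => le_rfl) ⟨0, 1, one_pos, fun x => by simp⟩
  have hmix : ∀ t, (∀ x, wt t * gaussianDensity (μt t) (St t) x = Real.exp (h t x)) →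
      ∀ x, mixture (Function.update w k (wt t)) (Function.update μ k (μt t))
        (Function.update S k (St t)) x = Real.exp (h t x) + R x := by
    intro t ht x
    rw [mixture, ← Finset.add_sum_erase _ _ (Finset.mem_univ k)]
    congr 1
    · simpa using ht x
    · refine Finset.sum_congr rfl fun l hl => ?_
      simp [Function.update_of_ne (Finset.ne_of_mem_erase hl)]
  have hpos : ∀ t x, 0 < Real.exp (h t x) + R x := fun t x =>
    add_pos_of_pos_of_nonneg (Real.exp_pos _) (hR0 x)
  have hdiff := (hd1.fun_neg.fun_add hd2).add_const
    (∑ l ∈ Finset.univ.erase k, w l * ∫ x, gaussianDensity (μ l) (S l) x *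
      Real.log (w l * gaussianDensity (μ l) (S l) x))
  refine (hdiff.congr_of_eventuallyEq ?_).congr_deriv ?_
  · filter_upwards [hg] with t ht
    have h1 : approxEntropy (Function.update w k (wt t)) (Function.update μ k (μt t))
        (Function.update S k (St t)) =
        -(∫ x, (Real.exp (h t x) + 0) * Real.log (Real.exp (h t x) + 0)) -
        ∑ l ∈ Finset.univ.erase k, w l * ∫ x, gaussianDensity (μ l) (S l) x *
          Real.log (w l * gaussianDensity (μ l) (S l) x) := by
      rw [approxEntropy, ← Finset.add_sum_erase _ _ (Finset.mem_univ k), neg_add, sub_eq_add_neg]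
      congr 2
      · simp only [Function.update_self]
        rw [← integral_const_mul]
        refine integral_congr_ae (Filter.Eventually.of_forall fun x => ?_)
        simp only
        rw [← mul_assoc, ht x, add_zero]
      · refine Finset.sum_congr rfl fun l hl => ?_
        simp [Function.update_of_ne (Finset.ne_of_mem_erase hl)]
    rw [entropyError, h1, entropy]
    simp only [hmix t ht]
    ring
  -- The two summands `+ 1` cancel, leaving log q − log g.
  · rw [← sub_eq_neg_add, ← neg_sub, ← integral_sub hi1 hi2]
    congr 1
    refine integral_congr_ae (Filter.Eventually.of_forall fun x => ?_)
    have h0 := hg.self_of_nhds x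
    have h1 := hmix t₀ hg.self_of_nhds x
    rw [hw₀, hμ₀, hS₀] at h0 h1
    simp only [Function.update_eq_self] at h1
    simp only
    rw [h0, h1, Real.log_div (hpos t₀ x).ne' (Real.exp_pos _).ne', add_zero]
    ring

/-! ### Gaussian moments and Cauchy–Schwarz -/

theorem integral_even_pow_mul_exp_neg_mul_sq (n : ℕ) {b : ℝ} (hb : 0 < b) :
    Integrable (fun y : ℝ => y ^ (2 * n) * Real.exp (-b * y ^ 2)) ∧
    ∫ y : ℝ, y ^ (2 * n) * Real.exp (-b * y ^ 2) =
      b ^ (-((n : ℝ) + 1 / 2)) * Real.Gamma ((n : ℝ) + 1 / 2) := by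
  have hn : (-1 : ℝ) < ((2 * n : ℕ) : ℝ) := by
    have : (0 : ℝ) ≤ ((2 * n : ℕ) : ℝ) := Nat.cast_nonneg _
    linarith
  constructor
  · have := integrable_rpow_mul_exp_neg_mul_sq hb hn
    simpa only [Real.rpow_natCast] using this
  -- The integrand is even, which reduces the integral to a half-line Gamma integral.
  · have h1 : ∀ y : ℝ, y ^ (2 * n) * Real.exp (-b * y ^ 2) =
        (fun z : ℝ => z ^ (2 * n) * Real.exp (-b * z ^ 2)) |y| := by
      intro y
      simp only [pow_mul, sq_abs]
    rw [integral_congr_ae (Filter.Eventually.of_forall h1),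
      integral_comp_abs (f := fun z : ℝ => z ^ (2 * n) * Real.exp (-b * z ^ 2))]
    have h2 := integral_rpow_mul_exp_neg_mul_rpow (p := 2) two_pos hn hb
    simp only [Real.rpow_natCast, Real.rpow_two] at h2
    rw [h2]
    push_cast
    have h3 : (2 * (n : ℝ) + 1) / 2 = n + 1 / 2 := by ring
    rw [neg_div, h3]
    ring

/-- For n = 0 the truncated subtraction gives 0‼ = 1, the correct zeroth moment. -/
theorem integral_even_pow_mul_gaussian (n : ℕ) {r : ℝ} (hr : 0 < r) :
    Integrable (fun y : ℝ => y ^ (2 * n) * ((√(2 * Real.pi))⁻¹ * Real.exp (-(r / 2) * y ^ 2))) ∧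
    ∫ y : ℝ, y ^ (2 * n) * ((√(2 * Real.pi))⁻¹ * Real.exp (-(r / 2) * y ^ 2)) =
      ((2 * n - 1).doubleFactorial : ℝ) * r ^ (-((n : ℝ) + 1 / 2)) := by
  obtain ⟨h1, h2⟩ := integral_even_pow_mul_exp_neg_mul_sq n (half_pos hr)
  have h3 : (fun y : ℝ => y ^ (2 * n) * ((√(2 * Real.pi))⁻¹ * Real.exp (-(r / 2) * y ^ 2))) =
      fun y => (√(2 * Real.pi))⁻¹ * (y ^ (2 * n) * Real.exp (-(r / 2) * y ^ 2)) := by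
    funext y
    ring
  rw [h3]
  refine ⟨h1.const_mul _, ?_⟩
  rw [integral_const_mul, h2, Real.Gamma_nat_add_half, Real.div_rpow hr.le two_pos.le,
    Real.rpow_neg two_pos.le, Real.rpow_add two_pos, Real.rpow_natCast, ← Real.sqrt_eq_rpow,
    Real.sqrt_mul two_pos.le]
  have : √Real.pi ≠ 0 := by positivity
  field_simp

theorem integral_prod_even_pow_mul_gaussian {m : ℕ} (e : Fin m → ℕ) {r : ℝ} (hr : 0 < r) :
    Integrable (fun y : Fin m → ℝ => (∏ i, y i ^ (2 * e i)) *
      Real.exp (-((m : ℝ) / 2 * Real.log (2 * Real.pi)) - r / 2 * (y ⬝ᵥ y))) ∧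
    ∫ y : Fin m → ℝ, (∏ i, y i ^ (2 * e i)) *
      Real.exp (-((m : ℝ) / 2 * Real.log (2 * Real.pi)) - r / 2 * (y ⬝ᵥ y)) =
      (∏ i, ((2 * e i - 1).doubleFactorial : ℝ)) * r ^ (-((m : ℝ) / 2 + ∑ i, (e i : ℝ))) := by
  have h1 : ∀ y : Fin m → ℝ, (∏ i, y i ^ (2 * e i)) *
      Real.exp (-((m : ℝ) / 2 * Real.log (2 * Real.pi)) - r / 2 * (y ⬝ᵥ y)) =
      ∏ i, (fun i z => z ^ (2 * e i) * ((√(2 * Real.pi))⁻¹ * Real.exp (-(r / 2) * z ^ 2))) i (y i) := by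
    intro y
    have h2 : (√(2 * Real.pi))⁻¹ = Real.exp (-(1 / 2 * Real.log (2 * Real.pi))) := by
      rw [Real.exp_neg, mul_comm (1 / 2 : ℝ), Real.exp_mul, Real.exp_log (by positivity), ← Real.sqrt_eq_rpow]
    simp only [Finset.prod_mul_distrib, h2, ← Real.exp_sum, ← Real.exp_add]
    congr 2
    simp only [dotProduct, Finset.mul_sum, Finset.sum_add_distrib, Finset.sum_const,
      Finset.card_univ, Fintype.card_fin, nsmul_eq_mul, neg_mul, Finset.sum_neg_distrib, sq]
    ring
  rw [funext h1]
  constructor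
  · exact Integrable.fintype_prod (fun i => (integral_even_pow_mul_gaussian (e i) hr).1)
  · rw [integral_fintype_prod_volume_eq_prod (fun i z => z ^ (2 * e i) *
      ((√(2 * Real.pi))⁻¹ * Real.exp (-(r / 2) * z ^ 2)))]
    simp_rw [fun i => (integral_even_pow_mul_gaussian (e i) hr).2]
    rw [Finset.prod_mul_distrib, ← Real.rpow_sum_of_pos hr]
    congr 2
    simp [Finset.sum_add_distrib]
    ring

/-- Linear change of variables. -/
theorem integral_comp_inv_mulVec_sub {m : ℕ} {G : Matrix (Fin m) (Fin m) ℝ} (hG : G.det ≠ 0)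
    (μ : Fin m → ℝ) {F : (Fin m → ℝ) → ℝ} (hF : Integrable F) :
    Integrable (fun x => F (G⁻¹ *ᵥ (x - μ))) ∧
    ∫ x, F (G⁻¹ *ᵥ (x - μ)) = |G.det| * ∫ y, F y := by
  have hG' : G⁻¹.det ≠ 0 := by simpa [Matrix.det_nonsing_inv] using hG
  have hmap := Real.map_matrix_volume_pi_eq_smul_volume_pi hG'
  have hemb : MeasurableEmbedding (Matrix.toLin' G⁻¹) := by
    refine Continuous.measurableEmbedding (LinearMap.continuous_of_finiteDimensional _) ?_
    intro x y hxy
    simp only [Matrix.toLin'_apply] at hxy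
    exact Matrix.mulVec_injective_iff_isUnit.2
      ((Matrix.isUnit_iff_isUnit_det _).2 (isUnit_iff_ne_zero.2 hG')) hxy
  have h1 : Integrable (fun x => F (G⁻¹ *ᵥ x)) := by
    have h2 : Integrable F (Measure.map (Matrix.toLin' G⁻¹) volume) := by
      rw [hmap]
      exact hF.smul_measure ENNReal.ofReal_ne_top
    exact (hemb.integrable_map_iff).1 h2
  refine ⟨h1.comp_sub_right μ, ?_⟩
  have h3 : ∫ x, F (G⁻¹ *ᵥ (x - μ)) = ∫ x, F (G⁻¹ *ᵥ x) :=
    integral_sub_right_eq_self (fun x => F (G⁻¹ *ᵥ x)) μ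
  have h4 := hemb.integral_map (μ := volume) F
  rw [hmap, integral_smul_measure, Matrix.det_nonsing_inv, Ring.inverse_eq_inv', inv_inv,
    ENNReal.toReal_ofReal (abs_nonneg _)] at h4
  rw [h3]
  simpa using h4.symm

/-- Even moments of an exponentially tilted Gaussian. -/
theorem integral_prod_even_pow_mul_gaussianDensity {m : ℕ} {S : Matrix (Fin m) (Fin m) ℝ}
    (hS : S.PosDef) (μ : Fin m → ℝ) (e : Fin m → ℕ) {s : ℝ} (hs : s < 1) :
    Integrable (fun x => (∏ i, ((CFC.sqrt S)⁻¹ *ᵥ (x - μ)) i ^ (2 * e i)) *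
      (gaussianDensity μ S x *
        Real.exp (s / 2 * ‖mulVecEuclidean (CFC.sqrt S)⁻¹ (x - μ)‖ ^ 2))) ∧
    ∫ x, (∏ i, ((CFC.sqrt S)⁻¹ *ᵥ (x - μ)) i ^ (2 * e i)) *
      (gaussianDensity μ S x *
        Real.exp (s / 2 * ‖mulVecEuclidean (CFC.sqrt S)⁻¹ (x - μ)‖ ^ 2)) =
      (∏ i, ((2 * e i - 1).doubleFactorial : ℝ)) *
        (1 - s) ^ (-((m : ℝ) / 2 + ∑ i, (e i : ℝ))) := by
  have hdet := (posDef_sqrt hS).det_pos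
  obtain ⟨h1, h2⟩ := integral_prod_even_pow_mul_gaussian e (sub_pos.2 hs)
  obtain ⟨h3, h4⟩ := integral_comp_inv_mulVec_sub hdet.ne' μ h1
  -- The tilt turns the exponent −‖y‖² / 2 into −(1 − s) ‖y‖² / 2; the factor `det⁻¹` will cancel
  -- the Jacobian.
  have h5 : ∀ x, (∏ i, ((CFC.sqrt S)⁻¹ *ᵥ (x - μ)) i ^ (2 * e i)) *
      (gaussianDensity μ S x *
        Real.exp (s / 2 * ‖mulVecEuclidean (CFC.sqrt S)⁻¹ (x - μ)‖ ^ 2)) =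
      (CFC.sqrt S).det⁻¹ * ((∏ i, ((CFC.sqrt S)⁻¹ *ᵥ (x - μ)) i ^ (2 * e i)) *
        Real.exp (-((m : ℝ) / 2 * Real.log (2 * Real.pi)) - (1 - s) / 2 *
          (((CFC.sqrt S)⁻¹ *ᵥ (x - μ)) ⬝ᵥ ((CFC.sqrt S)⁻¹ *ᵥ (x - μ))))) := by
    intro x
    rw [mul_left_comm (CFC.sqrt S).det⁻¹]
    congr 1
    rw [gaussianDensity_eq hS, ← Real.exp_add, norm_sq_mulVecEuclidean]
    rw [← Real.exp_log (inv_pos.2 hdet), Real.log_inv, ← Real.exp_add]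
    refine congrArg Real.exp ?_
    ring
  simp_rw [h5]
  refine ⟨h3.const_mul _, ?_⟩
  rw [integral_const_mul, h4, h2, abs_of_pos hdet, inv_mul_cancel_left₀ hdet.ne']

/-- The Cauchy-Schwarz inequality for square roots of integrable functions. -/
theorem integral_sqrt_mul_sqrt_le {α : Type*} [MeasurableSpace α] {ν : Measure α} {f g : α → ℝ}
    (hf : Integrable f ν) (hg : Integrable g ν) (hf0 : ∀ x, 0 ≤ f x) (hg0 : ∀ x, 0 ≤ g x) :
    Integrable (fun x => √(f x) * √(g x)) ν ∧
    ∫ x, √(f x) * √(g x) ∂ν ≤ √(∫ x, f x ∂ν) * √(∫ x, g x ∂ν) := by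
  have hL : ∀ {f : α → ℝ}, Integrable f ν → (∀ x, 0 ≤ f x) → MemLp (fun x => √(f x)) 2 ν := by
    intro f hf hf0
    rw [memLp_two_iff_integrable_sq (Real.continuous_sqrt.comp_aestronglyMeasurable hf.1)]
    simpa only [Real.sq_sqrt (hf0 _)] using hf
  refine ⟨(hL hf hf0).integrable_mul (hL hg hg0), ?_⟩
  have h := integral_mul_le_Lp_mul_Lq_of_nonneg (μ := ν) Real.HolderConjugate.two_two
    (Filter.Eventually.of_forall fun x => Real.sqrt_nonneg (f x))
    (Filter.Eventually.of_forall fun x => Real.sqrt_nonneg (g x))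
    (by simpa using hL hf hf0) (by simpa using hL hg hg0)
  simpa only [Real.rpow_two, Real.sq_sqrt (hf0 _), Real.sq_sqrt (hg0 _), ← Real.sqrt_eq_rpow]
    using h

/-! ### Overlap of two components -/

theorem toEuclideanCLM_mulVecEuclidean {m : ℕ} (A B : Matrix (Fin m) (Fin m) ℝ) (x : Fin m → ℝ) :
    Matrix.toEuclideanCLM (n := Fin m) (𝕜 := ℝ) A (mulVecEuclidean B x) =
      mulVecEuclidean (A * B) x := by
  rw [mulVecEuclidean_apply, mulVecEuclidean_apply, Matrix.toEuclideanCLM_toLp,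
    Matrix.mulVec_mulVec]

section Pair

variable {K m : ℕ} {μ : Fin K → Fin m → ℝ} {S : Fin K → Matrix (Fin m) (Fin m) ℝ}

theorem alpha_nonneg (k l : Fin K) : 0 ≤ alpha μ S k l :=
  div_nonneg (Real.sqrt_nonneg _) (add_nonneg zero_le_one (norm_nonneg _))

/-- Split μ_k − μ_l at x and whiten by component `k`. The leg from x to μ_l is Γ_k⁻¹ Γ_l applied to
its own whitened form, so the numerator of α is at most a + ‖Γ_k⁻¹ Γ_l‖ b ≤ (1 + ‖Γ_k⁻¹ Γ_l‖) max
(a, b). -/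
theorem alpha_le_max (hS : ∀ k, (S k).PosDef) (k l : Fin K) (x : Fin m → ℝ) :
    alpha μ S k l ≤ max ‖mulVecEuclidean (rootCov S k)⁻¹ (x - μ k)‖
      ‖mulVecEuclidean (rootCov S l)⁻¹ (x - μ l)‖ := by
  set a := ‖mulVecEuclidean (rootCov S k)⁻¹ (x - μ k)‖
  set b := ‖mulVecEuclidean (rootCov S l)⁻¹ (x - μ l)‖ with hb
  have hop : 0 ≤ opNorm ((rootCov S k)⁻¹ * rootCov S l) := norm_nonneg _
  have h1 : mnorm (S k) (μ k - μ l) ≤ a + opNorm ((rootCov S k)⁻¹ * rootCov S l) * b := by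
    have h2 : mnorm (S k) (μ k - μ l) = ‖mulVecEuclidean (rootCov S k)⁻¹ (μ k - μ l)‖ := by
      conv_lhs => rw [← sqrt_mul_transpose (hS k)]
      exact mnorm_mul_transpose _
    have h3 : mulVecEuclidean (rootCov S k)⁻¹ (x - μ l) =
        Matrix.toEuclideanCLM (n := Fin m) (𝕜 := ℝ) ((rootCov S k)⁻¹ * rootCov S l)
          (mulVecEuclidean (rootCov S l)⁻¹ (x - μ l)) := by
      rw [toEuclideanCLM_mulVecEuclidean, Matrix.mul_nonsing_inv_cancel_right (rootCov S l) _
        (isUnit_iff_ne_zero.2 (posDef_sqrt (hS l)).det_pos.ne')]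
    have h4 : μ k - μ l = (x - μ l) - (x - μ k) := by abel
    rw [h2, h4, map_sub, h3]
    refine (norm_sub_le _ _).trans ?_
    rw [add_comm]
    exact add_le_add le_rfl (ContinuousLinearMap.le_opNorm _ _)
  rw [alpha, div_le_iff₀ (by linarith)]
  have h5 : a ≤ max a b := le_max_left _ _
  have h6 : b ≤ max a b := le_max_right _ _
  nlinarith [mul_le_mul_of_nonneg_left h6 hop]

/-- At least one whitened distance reaches the larger α, so one of the two exponentials already
outweighs the decay factor. The sum avoids splitting the domain of integration. -/
theorem one_le_decay_mul (hS : ∀ k, (S k).PosDef) {s : ℝ} (hs : 0 < s) (k l : Fin K)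
    (x : Fin m → ℝ) :
    1 ≤ decay s μ S k l *
      (Real.exp (s / 4 * ‖mulVecEuclidean (rootCov S k)⁻¹ (x - μ k)‖ ^ 2) +
        Real.exp (s / 4 * ‖mulVecEuclidean (rootCov S l)⁻¹ (x - μ l)‖ ^ 2)) := by
  set a := ‖mulVecEuclidean (rootCov S k)⁻¹ (x - μ k)‖ with ha
  set b := ‖mulVecEuclidean (rootCov S l)⁻¹ (x - μ l)‖ with hb
  have h1 : max (alpha μ S k l) (alpha μ S l k) ≤ max a b :=
    max_le (alpha_le_max hS k l x) ((alpha_le_max hS l k x).trans_eq (max_comm _ _))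
  have h0 : 0 ≤ max (alpha μ S k l) (alpha μ S l k) := (alpha_nonneg k l).trans (le_max_left _ _)
  rw [decay, mul_add, ← Real.exp_add, ← Real.exp_add]
  set α := max (alpha μ S k l) (alpha μ S l k)
  have key : ∀ c, α ≤ c → 1 ≤ Real.exp (-(s * α ^ 2 / 4) + s / 4 * c ^ 2) := fun c hc => by
    rw [Real.one_le_exp_iff]
    have := pow_le_pow_left₀ h0 hc 2
    nlinarith
  rcases le_max_iff.1 h1 with h | h
  · exact (key a h).trans (le_add_of_nonneg_right (Real.exp_pos _).le)
  · exact (key b h).trans (le_add_of_nonneg_left (Real.exp_pos _).le)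

/-- Mixed moments of the geometric mean of two Gaussian densities. -/
theorem integral_prod_pow_mul_sqrt_gaussianDensity_le (hS : ∀ k, (S k).PosDef) {s : ℝ}
    (hs : s ∈ Set.Ioo (0 : ℝ) 1) (k l : Fin K) (e : Fin m → ℕ) :
    Integrable (fun x => (∏ i, |((rootCov S k)⁻¹ *ᵥ (x - μ k)) i| ^ e i) *
      √(gaussianDensity (μ k) (S k) x * gaussianDensity (μ l) (S l) x)) ∧
    ∫ x, (∏ i, |((rootCov S k)⁻¹ *ᵥ (x - μ k)) i| ^ e i) *
      √(gaussianDensity (μ k) (S k) x * gaussianDensity (μ l) (S l) x) ≤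
      2 * √(∏ i, ((2 * e i - 1).doubleFactorial : ℝ)) / (1 - s) ^ (((m : ℝ) + 2 * ∑ i, (e i : ℝ)) / 4)
        * decay s μ S k l := by
  obtain ⟨hs0, hs1⟩ := hs
  set f : (Fin m → ℝ) → ℝ := gaussianDensity (μ k) (S k) with hf
  set g : (Fin m → ℝ) → ℝ := gaussianDensity (μ l) (S l) with hg
  set a : (Fin m → ℝ) → ℝ := fun x => ‖mulVecEuclidean (rootCov S k)⁻¹ (x - μ k)‖ with ha
  set b : (Fin m → ℝ) → ℝ := fun x => ‖mulVecEuclidean (rootCov S l)⁻¹ (x - μ l)‖ with hb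
  set P : (Fin m → ℝ) → ℝ := fun x => ∏ i, |((rootCov S k)⁻¹ *ᵥ (x - μ k)) i| ^ e i with hP
  set Q : (Fin m → ℝ) → ℝ := fun x => ∏ i, ((rootCov S k)⁻¹ *ᵥ (x - μ k)) i ^ (2 * e i) with hQ
  set c : ℝ := ∏ i, ((2 * e i - 1).doubleFactorial : ℝ) with hc
  set N : ℝ := ∑ i, (e i : ℝ) with hN
  have hc0 : 0 ≤ c := Finset.prod_nonneg fun i _ => Nat.cast_nonneg _
  have hN0 : 0 ≤ N := Finset.sum_nonneg fun i _ => Nat.cast_nonneg _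
  have hf0 : ∀ x, 0 < f x := gaussianDensity_pos (hS k) _
  have hg0 : ∀ x, 0 < g x := gaussianDensity_pos (hS l) _
  have hP0 : ∀ x, 0 ≤ P x := fun x => Finset.prod_nonneg fun i _ => by positivity
  have hQP : ∀ x, Q x = P x ^ 2 := fun x => by
    simp only [hQ, hP, ← Finset.prod_pow]
    refine Finset.prod_congr rfl fun i _ => ?_
    rw [← pow_mul, mul_comm (e i), pow_mul |_|, sq_abs, pow_mul]
  have hQ0 : ∀ x, 0 ≤ Q x := fun x => by
    rw [hQP]
    positivity
  have hdec : 0 ≤ decay s μ S k l := (Real.exp_pos _).le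
  obtain ⟨i1, v1⟩ := integral_prod_even_pow_mul_gaussianDensity (hS k) (μ k) e hs1
  obtain ⟨i2, v2⟩ := integral_prod_even_pow_mul_gaussianDensity (hS k) (μ k) e (s := 0) one_pos
  obtain ⟨i3, v3⟩ := integral_prod_even_pow_mul_gaussianDensity (hS l) (μ l) (fun _ => 0) hs1
  obtain ⟨i4, v4⟩ :=
    integral_prod_even_pow_mul_gaussianDensity (hS l) (μ l) (fun _ => 0) (s := 0) one_pos
  simp only [mul_zero, pow_zero, Finset.prod_const_one, one_mul, zero_div, zero_mul,
    Real.exp_zero, mul_one, sub_zero, Real.one_rpow, Nat.zero_sub, Nat.doubleFactorial,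
    Nat.cast_one, Nat.cast_zero, Finset.sum_const_zero, add_zero] at i2 v2 i3 v3 i4 v4
  -- One application per exponential: the tilt falls on component `k` in the first and on `l` in the
  -- second. The polynomial always stays with `k`.
  obtain ⟨j1, u1⟩ := integral_sqrt_mul_sqrt_le i1 i4
    (fun x => mul_nonneg (hQ0 x) (mul_nonneg (hf0 x).le (Real.exp_pos _).le)) (fun x => (hg0 x).le)
  obtain ⟨j2, u2⟩ := integral_sqrt_mul_sqrt_le i2 i3
    (fun x => mul_nonneg (hQ0 x) (hf0 x).le) (fun x => mul_nonneg (hg0 x).le (Real.exp_pos _).le)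
  rw [v1, v4] at u1
  rw [v2, v3] at u2
  have hexp : ∀ r : ℝ, √(Real.exp (s / 2 * r ^ 2)) = Real.exp (s / 4 * r ^ 2) := fun r => by
    rw [← Real.exp_half]
    congr 1
    ring
  have hpt : ∀ x, P x * √(f x * g x) ≤ decay s μ S k l *
      (√(Q x * (f x * Real.exp (s / 2 * a x ^ 2))) * √(g x) +
        √(Q x * f x) * √(g x * Real.exp (s / 2 * b x ^ 2))) := by
    intro x
    have h1 : √(Q x * (f x * Real.exp (s / 2 * a x ^ 2))) =
        P x * (√(f x) * Real.exp (s / 4 * a x ^ 2)) := by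
      rw [Real.sqrt_mul (hQ0 x), Real.sqrt_mul (hf0 x).le, hQP, Real.sqrt_sq (hP0 x), hexp]
    have h2 : √(Q x * f x) = P x * √(f x) := by
      rw [Real.sqrt_mul (hQ0 x), hQP, Real.sqrt_sq (hP0 x)]
    have h3 : √(g x * Real.exp (s / 2 * b x ^ 2)) = √(g x) * Real.exp (s / 4 * b x ^ 2) := by
      rw [Real.sqrt_mul (hg0 x).le, hexp]
    rw [h1, h2, h3, Real.sqrt_mul (hf0 x).le]
    have h4 := one_le_decay_mul (μ := μ) hS hs0 k l x
    have h5 : 0 ≤ P x * (√(f x) * √(g x)) := by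
      have := hP0 x
      positivity
    have h6 := mul_le_mul_of_nonneg_left h4 h5
    simp only [ha, hb]
    linarith
  have hdom := (j1.add j2).const_mul (decay s μ S k l)
  have hfc : Continuous f := continuous_gaussianDensity (hS k) _
  have hgc : Continuous g := continuous_gaussianDensity (hS l) _
  have hPc : Continuous P := by
    simp only [hP]
    fun_prop
  have hint : Integrable (fun x => P x * √(f x * g x)) := by
    refine hdom.mono' (by fun_prop) (Filter.Eventually.of_forall fun x => ?_)
    rw [Real.norm_of_nonneg (mul_nonneg (hP0 x) (Real.sqrt_nonneg _))]
    exact hpt x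
  refine ⟨hint, (integral_mono hint hdom hpt).trans ?_⟩
  rw [integral_const_mul]
  simp only [Pi.add_apply]
  rw [integral_add j1 j2, mul_comm]
  refine mul_le_mul_of_nonneg_right ?_ hdec
  have hr : 0 < 1 - s := sub_pos.2 hs1
  have hsq : ∀ z : ℝ, √((1 - s) ^ z) = (1 - s) ^ (z / 2) := fun z => by
    rw [Real.sqrt_eq_rpow, ← Real.rpow_mul hr.le]
    ring_nf
  -- With the tilt on `l`, the moment order does not enter the exponent. As 0 < 1 − s < 1, that
  -- power is dominated by the one from the tilt on `k`.
  have hmono : (1 - s) ^ (-((m : ℝ) / 2) / 2) ≤ (1 - s) ^ (-((m : ℝ) / 2 + N) / 2) :=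
    Real.rpow_le_rpow_of_exponent_ge hr (by linarith) (by linarith)
  have hfin : (1 - s) ^ (-((m : ℝ) / 2 + N) / 2) = 1 / (1 - s) ^ (((m : ℝ) + 2 * N) / 4) := by
    rw [one_div, ← Real.rpow_neg hr.le]
    congr 1
    ring
  rw [Real.sqrt_mul hc0, hsq, Real.sqrt_one, mul_one] at u1
  rw [hsq] at u2
  have u3 := mul_le_mul_of_nonneg_left hmono (Real.sqrt_nonneg c)
  rw [hfin] at u1 u3
  have h7 : 2 * √c / (1 - s) ^ (((m : ℝ) + 2 * N) / 4) =
    2 * (√c * (1 / (1 - s) ^ (((m : ℝ) + 2 * N) / 4))) := by ring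
  rw [h7]
  linarith

end Pair

/-! ### From the logarithm of the mixture to pairwise overlaps -/

theorem log_one_add_le_sqrt {u : ℝ} (hu : 0 ≤ u) : Real.log (1 + u) ≤ √u := by
  rw [Real.log_le_iff_le_exp (by linarith)]
  have h1 := Real.sum_le_exp_of_nonneg (Real.sqrt_nonneg u) 4
  have h2 := Real.sq_sqrt hu
  set v := √u
  have hv : 0 ≤ v := Real.sqrt_nonneg u
  simp [Finset.sum_range_succ, Nat.factorial] at h1
  -- With v = √u, the cubic Taylor bound reduces the claim to v (v² − 3v + 6) ≥ 0; the quadratic is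
  -- (v − 3/2)² + 15/4.
  nlinarith [mul_nonneg hv (sq_nonneg (v - 3 / 2))]

theorem sqrt_sum_le_sum_sqrt {ι : Type*} (t : Finset ι) (f : ι → ℝ) :
    √(∑ i ∈ t, f i) ≤ ∑ i ∈ t, √(f i) :=
  Finset.le_sum_of_subadditive (fun z : ℝ => √z) Real.sqrt_zero.le
    (fun x y => by
      rcases le_or_gt x 0 with hx | hx
      · exact (Real.sqrt_le_sqrt (by linarith)).trans
          (le_add_of_nonneg_left (Real.sqrt_nonneg x))
      rcases le_or_gt y 0 with hy | hy
      · exact (Real.sqrt_le_sqrt (by linarith)).trans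
          (le_add_of_nonneg_right (Real.sqrt_nonneg y))
      rw [Real.sqrt_le_left (by positivity)]
      nlinarith [Real.sq_sqrt hx.le, Real.sq_sqrt hy.le,
        mul_nonneg (Real.sqrt_nonneg x) (Real.sqrt_nonneg y)]) t f

section

variable {K m : ℕ} {w : Fin K → ℝ} {μ : Fin K → Fin m → ℝ}
    {S : Fin K → Matrix (Fin m) (Fin m) ℝ}

/-- The logarithmic overlap of a component with the mixture is bounded by pairwise overlaps. -/
theorem mul_log_mixture_div_le (hw : ∀ k, 0 < w k) (hS : ∀ k, (S k).PosDef) (k : Fin K)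
    (x : Fin m → ℝ) :
    0 ≤ Real.log (mixture w μ S x / (w k * gaussianDensity (μ k) (S k) x)) ∧
    w k * gaussianDensity (μ k) (S k) x *
        Real.log (mixture w μ S x / (w k * gaussianDensity (μ k) (S k) x)) ≤
      ∑ l ∈ Finset.univ.erase k, √(w k * w l) *
        √(gaussianDensity (μ k) (S k) x * gaussianDensity (μ l) (S l) x) := by
  set g : Fin K → ℝ := fun l => w l * gaussianDensity (μ l) (S l) x with hg
  have hg0 : ∀ l, 0 < g l := fun l => mul_pos (hw l) (gaussianDensity_pos (hS l) _ _)
  have hmix : mixture w μ S x / g k = 1 + ∑ l ∈ Finset.univ.erase k, g l / g k := by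
    rw [mixture, ← Finset.add_sum_erase _ _ (Finset.mem_univ k), ← Finset.sum_div, add_div,
      div_self (hg0 k).ne']
  have hu : 0 ≤ ∑ l ∈ Finset.univ.erase k, g l / g k :=
    Finset.sum_nonneg fun l _ => (div_pos (hg0 l) (hg0 k)).le
  change 0 ≤ Real.log (mixture w μ S x / g k) ∧ g k * Real.log (mixture w μ S x / g k) ≤ _
  rw [hmix]
  refine ⟨Real.log_nonneg (by linarith), ?_⟩
  have h1 := (log_one_add_le_sqrt hu).trans (sqrt_sum_le_sum_sqrt _ _)
  refine (mul_le_mul_of_nonneg_left h1 (hg0 k).le).trans_eq ?_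
  rw [Finset.mul_sum]
  refine Finset.sum_congr rfl fun l _ => ?_
  have h2 : √(w k * w l) * √(gaussianDensity (μ k) (S k) x * gaussianDensity (μ l) (S l) x) =
      √(g k) * √(g l) := by
    rw [← Real.sqrt_mul (mul_pos (hw k) (hw l)).le, ← Real.sqrt_mul (hg0 k).le]
    congr 1
    simp only [hg]
    ring
  rw [h2, Real.sqrt_div (hg0 l).le]
  have h3 := Real.mul_self_sqrt (hg0 k).le
  have h4 : √(g k) ≠ 0 := (Real.sqrt_pos.2 (hg0 k)).ne'
  rw [← mul_div_assoc, div_eq_iff h4]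
  linear_combination -√(g l) * h3

/-- The common reduction for all three derivatives: `φ` is the score, `Φ` a majorant of it, and `B
l` a bound for the resulting moment of the overlap with component `l`. -/
theorem abs_integral_log_mixture_div_le (hw : ∀ k, 0 < w k) (hS : ∀ k, (S k).PosDef) (k : Fin K)
    {φ Φ : (Fin m → ℝ) → ℝ} {B : Fin K → ℝ} (hφ : ∀ x, |φ x| ≤ Φ x)
    (hΦ : ∀ l, Integrable (fun x => Φ x *
      √(gaussianDensity (μ k) (S k) x * gaussianDensity (μ l) (S l) x)) ∧
      ∫ x, Φ x * √(gaussianDensity (μ k) (S k) x * gaussianDensity (μ l) (S l) x) ≤ B l) :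
    |-∫ x, w k * gaussianDensity (μ k) (S k) x * φ x *
        Real.log (mixture w μ S x / (w k * gaussianDensity (μ k) (S k) x))| ≤
      ∑ l ∈ Finset.univ.erase k, √(w k * w l) * B l := by
  have hi : Integrable (fun x => ∑ l ∈ Finset.univ.erase k, √(w k * w l) * (Φ x *
      √(gaussianDensity (μ k) (S k) x * gaussianDensity (μ l) (S l) x))) :=
    integrable_finsetSum _ fun l _ => (hΦ l).1.const_mul _
  rw [abs_neg, ← Real.norm_eq_abs]
  refine (norm_integral_le_of_norm_le hi (Filter.Eventually.of_forall fun x => ?_)).trans ?_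
  · obtain ⟨h1, h2⟩ := mul_log_mixture_div_le (μ := μ) hw hS k x
    have h3 : 0 < w k * gaussianDensity (μ k) (S k) x :=
      mul_pos (hw k) (gaussianDensity_pos (hS k) _ _)
    rw [norm_mul, norm_mul, Real.norm_of_nonneg h3.le, Real.norm_of_nonneg h1, Real.norm_eq_abs]
    have h4 := mul_le_mul (hφ x) h2 (mul_nonneg h3.le h1) ((abs_nonneg _).trans (hφ x))
    rw [Finset.mul_sum] at h4
    refine (le_of_eq ?_).trans (h4.trans_eq (Finset.sum_congr rfl fun l _ => ?_)) <;> ring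
  · rw [integral_finsetSum]
    swap
    · exact fun l _ => (hΦ l).1.const_mul _
    refine Finset.sum_le_sum fun l _ => ?_
    rw [integral_const_mul]
    exact mul_le_mul_of_nonneg_left (hΦ l).2 (Real.sqrt_nonneg _)

theorem exp_log_add_gaussian (hS : ∀ k, (S k).PosDef) (k : Fin K)
    (ν x : Fin m → ℝ) {r : ℝ} (hr : 0 < r) :
    r * gaussianDensity ν (S k) x = Real.exp ((Real.log r +
      (-((m : ℝ) / 2 * Real.log (2 * Real.pi)) - Real.log (rootCov S k).det)) -
      ‖mulVecEuclidean (rootCov S k)⁻¹ x - mulVecEuclidean (rootCov S k)⁻¹ ν‖ ^ 2 / 2) := by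
  rw [gaussianDensity_eq (hS k), ← map_sub, add_sub_assoc, Real.exp_add, Real.exp_log hr]
  rfl

end

/-! ### Inverse entries and the signed minor -/

section

variable {m : ℕ}

theorem posDef_inv_sqrt {S : Matrix (Fin m) (Fin m) ℝ} (hS : S.PosDef) :
    (CFC.sqrt S)⁻¹.PosDef := (posDef_sqrt hS).inv

theorem apply_comm_of_posDef {C : Matrix (Fin m) (Fin m) ℝ} (hC : C.PosDef) (i j : Fin m) :
    C i j = C j i := by
  have := hC.isHermitian.apply i j
  simpa using this.symm

theorem sq_apply_le_of_posDef {C : Matrix (Fin m) (Fin m) ℝ} (hC : C.PosDef) (i j : Fin m) :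
    C i j ^ 2 ≤ C i i * C j j := by
  -- Nonnegativity of a 2 × 2 principal minor; semidefiniteness allows i = j.
  have h1 := (hC.posSemidef.submatrix ![i, j]).det_nonneg
  rw [Matrix.det_fin_two] at h1
  simp [apply_comm_of_posDef hC j i] at h1
  linarith

theorem entryNorm_nonneg (A : Matrix (Fin m) (Fin m) ℝ) : 0 ≤ entryNorm A :=
  Finset.sum_nonneg fun _ _ => Finset.sum_nonneg fun _ _ => abs_nonneg _

theorem sum_abs_row_le_entryNorm (A : Matrix (Fin m) (Fin m) ℝ) (p : Fin m) :
    ∑ j, |A p j| ≤ entryNorm A :=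
  Finset.single_le_sum (f := fun i => ∑ j, |A i j|)
    (fun _ _ => Finset.sum_nonneg fun _ _ => abs_nonneg _) (Finset.mem_univ p)

theorem sum_abs_two_rows_le_entryNorm (A : Matrix (Fin m) (Fin m) ℝ) {p q : Fin m} (h : p ≠ q) :
    ∑ j, |A p j| + ∑ j, |A q j| ≤ entryNorm A := by
  have h1 : ∑ i ∈ {p, q}, ∑ j, |A i j| ≤ entryNorm A :=
    Finset.sum_le_sum_of_subset_of_nonneg (Finset.subset_univ _)
      fun _ _ _ => Finset.sum_nonneg fun _ _ => abs_nonneg _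
  rwa [Finset.sum_pair h] at h1

theorem abs_add_abs_le_sum {f : Fin m → ℝ} {p q : Fin m} (h : p ≠ q) :
    |f p| + |f q| ≤ ∑ j, |f j| := by
  rw [← Finset.sum_pair (f := fun j => |f j|) h]
  exact Finset.sum_le_sum_of_subset_of_nonneg (Finset.subset_univ _) fun _ _ _ => abs_nonneg _

/-- Cramer's rule for `minorDet`. -/
theorem inv_det_mul_minorDet (A : Matrix (Fin m) (Fin m) ℝ) (p q : Fin m) :
    A.det⁻¹ * minorDet A p q = (-1) ^ ((p : ℕ) + q) * A⁻¹ q p := by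
  cases m with
  | zero => exact p.elim0
  | succ n =>
    rw [Matrix.inv_def, Matrix.smul_apply, Ring.inverse_eq_inv', smul_eq_mul,
      Matrix.adjugate_fin_succ_eq_det_submatrix, minorDet]
    have h : ((-1 : ℝ) ^ ((p : ℕ) + q)) * (-1) ^ ((p : ℕ) + q) = 1 := by
      rw [← mul_pow]
      simp
    linear_combination (-(A.det⁻¹ * (A.submatrix p.succAbove q.succAbove).det)) * h

/-- The signed minor is harmful only when negative, which forces p ≠ q because diagonal entries of
A⁻¹ are positive. Then rows p and q both contribute to the entrywise norm, and their diagonal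
entries control the off-diagonal one through the 2 × 2 minor. -/
theorem minor_bound {A : Matrix (Fin m) (Fin m) ℝ} (hA : A.PosDef) (p q : Fin m) :
    2 * |A⁻¹ q p| + 4 * ∑ j, |A⁻¹ j p| ≤
      6 * (2 * A.det⁻¹ * minorDet A p q + entryNorm A⁻¹) := by
  have hC := hA.inv
  have hcol : ∑ j, |A⁻¹ j p| = ∑ j, |A⁻¹ p j| :=
    Finset.sum_congr rfl fun j _ => by rw [apply_comm_of_posDef hC]
  rw [hcol, mul_assoc 2, inv_det_mul_minorDet]
  set t := (-1) ^ ((p : ℕ) + q) * A⁻¹ q p with ht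
  have habs : |t| = |A⁻¹ q p| := by
    rw [ht, abs_mul, abs_pow]
    simp
  rw [← habs]
  have hrow := sum_abs_row_le_entryNorm A⁻¹ p
  have hE := entryNorm_nonneg A⁻¹
  rcases le_or_gt 0 t with h0 | h0
  · rw [abs_of_nonneg h0]
    linarith
  · have hpq : p ≠ q := by
      rintro rfl
      have h1 : 0 < t := by
        rw [ht, ← two_mul, pow_mul]
        simpa using hC.diag_pos
      linarith
    have h1 := sum_abs_two_rows_le_entryNorm A⁻¹ hpq
    have h2 := abs_add_abs_le_sum (f := fun j => A⁻¹ p j) hpq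
    have h3 := abs_add_abs_le_sum (f := fun j => A⁻¹ q j) hpq
    have h4 := sq_apply_le_of_posDef hC q p
    have h5 : 0 < A⁻¹ p p := hC.diag_pos
    have h6 : 0 < A⁻¹ q q := hC.diag_pos
    simp only [apply_comm_of_posDef hC p q, abs_of_pos h5, abs_of_pos h6] at h2 h3
    rw [← sq_abs] at h4
    rw [← habs] at h2 h3 h4
    have ht0 : |t| = -t := abs_of_neg h0
    -- After the two row bounds the deficit 14 |t| drops to 6 |t|. With a, b the diagonal entries,
    -- (2a + 6b)² = 4 (a − 3b)² + 48ab ≥ 36 t².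
    have h7 : 6 * |t| ≤ 2 * A⁻¹ p p + 6 * A⁻¹ q q := by
      refine abs_le_of_sq_le_sq' ?_ (by positivity) |>.2
      nlinarith [sq_nonneg (A⁻¹ p p - 3 * A⁻¹ q q), mul_pos h5 h6]
    linarith

end

/-! ### Perturbation of a single matrix entry -/

section

variable {m : ℕ}

theorem inner_mulVecEuclidean_single (A B : Matrix (Fin m) (Fin m) ℝ) (y : Fin m → ℝ) (p : Fin m) :
    inner ℝ (mulVecEuclidean A y) (mulVecEuclidean B (Pi.single p 1)) =
      ∑ j, B j p * (A *ᵥ y) j := by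
  simp [mulVecEuclidean_apply, PiLp.inner_apply]

theorem mulVecEuclidean_sub_smul (A B : Matrix (Fin m) (Fin m) ℝ) (c : ℝ) :
    mulVecEuclidean (A - c • B) = mulVecEuclidean A - c • mulVecEuclidean B := by
  ext x : 1
  simp [mulVecEuclidean_apply, Matrix.sub_mulVec, Matrix.smul_mulVec]

theorem setEntry_eq (A : Matrix (Fin m) (Fin m) ℝ) (p q : Fin m) (t : ℝ) :
    setEntry A p q t = A + (t - A p q) • Matrix.single p q 1 := by
  ext i j
  rw [setEntry, Matrix.updateRow_apply]
  split_ifs with h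
  · subst h
    by_cases hj : j = q
    · subst hj
      simp
    · simp [Function.update_of_ne hj, Matrix.single_apply_of_ne _ _ _ _ _ (fun h => hj h.2.symm)]
  · simp [Matrix.single_apply_of_ne _ _ _ _ _ (fun h' => h h'.1.symm)]

theorem det_setEntry {A : Matrix (Fin m) (Fin m) ℝ} (hA : A.det ≠ 0) (p q : Fin m) (t : ℝ) :
    (setEntry A p q t).det = A.det * (1 + (t - A p q) * A⁻¹ q p) := by
  have h1 : Function.update (A p) q t = A p + (t - A p q) • Pi.single q 1 := by
    ext j
    by_cases hj : j = q
    · subst hj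
      simp
    · simp [hj]
  rw [setEntry, h1, Matrix.det_updateRow_add, Matrix.updateRow_eq_self, Matrix.det_updateRow_smul,
    ← Matrix.adjugate_apply, Matrix.inv_def, Matrix.smul_apply, Ring.inverse_eq_inv', smul_eq_mul]
  field_simp

theorem single_mul_mul_single (A : Matrix (Fin m) (Fin m) ℝ) (p q : Fin m) :
    Matrix.single p q 1 * A * Matrix.single p q 1 = A q p • Matrix.single p q (1 : ℝ) := by
  simp [Matrix.single_mul_mul_single]

/-- The Sherman-Morrison formula for the change of a single entry. -/
theorem inv_setEntry {A : Matrix (Fin m) (Fin m) ℝ} (hA : A.det ≠ 0) (p q : Fin m) {t : ℝ}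
    (ht : 1 + (t - A p q) * A⁻¹ q p ≠ 0) :
    (setEntry A p q t)⁻¹ = A⁻¹ -
      ((t - A p q) / (1 + (t - A p q) * A⁻¹ q p)) • (A⁻¹ * Matrix.single p q 1 * A⁻¹) := by
  refine Matrix.inv_eq_left_inv ?_
  have h1 : A⁻¹ * A = 1 := Matrix.nonsing_inv_mul _ (isUnit_iff_ne_zero.2 hA)
  set r := t - A p q with hr
  set E : Matrix (Fin m) (Fin m) ℝ := Matrix.single p q 1
  have h2 : A⁻¹ * E * A⁻¹ * A = A⁻¹ * E := by rw [mul_assoc, h1, mul_one]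
  -- `E` has rank one, so the product stays in the span of 1 and A⁻¹ E and only a scalar identity
  -- remains.
  have h3 : A⁻¹ * E * A⁻¹ * E = A⁻¹ q p • (A⁻¹ * E) := by
    rw [mul_assoc, mul_assoc, ← mul_assoc E, single_mul_mul_single, Matrix.mul_smul]
  rw [setEntry_eq, sub_mul, mul_add, Matrix.smul_mul, mul_add, h1, Matrix.mul_smul,
    Matrix.mul_smul, h2, h3]
  have h4 : r - r / (1 + r * A⁻¹ q p) - r / (1 + r * A⁻¹ q p) * r * A⁻¹ q p = 0 := by
    field_simp
    ring
  have h5 : (1 : Matrix (Fin m) (Fin m) ℝ) + r • (A⁻¹ * E) -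
      (r / (1 + r * A⁻¹ q p)) • (A⁻¹ * E + r • A⁻¹ q p • (A⁻¹ * E)) =
      1 + (r - r / (1 + r * A⁻¹ q p) - r / (1 + r * A⁻¹ q p) * r * A⁻¹ q p) • (A⁻¹ * E) := by
    module
  rw [h5, h4, zero_smul, add_zero]

end

/-! ### The three partial derivatives -/

section

variable {K m : ℕ} {w : Fin K → ℝ} {μ : Fin K → Fin m → ℝ}
    {S : Fin K → Matrix (Fin m) (Fin m) ℝ}

theorem det_inv_rootCov_ne_zero (hS : ∀ k, (S k).PosDef) (k : Fin K) :
    (rootCov S k)⁻¹.det ≠ 0 := (posDef_inv_sqrt (hS k)).det_pos.ne'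

theorem decay_pos (s : ℝ) (k l : Fin K) : 0 < decay s μ S k l := Real.exp_pos _

theorem exists_hasDerivAt_weight (hw : ∀ k, 0 < w k) (hS : ∀ k, (S k).PosDef) {s : ℝ}
    (hs : s ∈ Set.Ioo (0 : ℝ) 1) (k : Fin K) :
    ∃ D : ℝ, HasDerivAt (fun t => entropyError (Function.update w k t) μ S) D (w k) ∧
      |D| ≤ 2 / (1 - s) ^ ((m : ℝ) / 4) *
        ∑ l ∈ Finset.univ.erase k, √(w l / w k) * decay s μ S k l := by
  set κ : ℝ := -((m : ℝ) / 2 * Real.log (2 * Real.pi)) - Real.log (rootCov S k).det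
  have hℓ : ContDiffAt ℝ 1 (fun t => Real.log t + κ) (w k) :=
    (Real.contDiffAt_log.2 (hw k).ne').add contDiffAt_const
  have hℓ' : deriv (fun t => Real.log t + κ) (w k) = (w k)⁻¹ := by simp
  have h := hasDerivAt_entropyError (wt := fun t => t) (μt := fun _ => μ k) (St := fun _ => S k)
    (L := fun _ => mulVecEuclidean (rootCov S k)⁻¹)
    (b := fun _ => mulVecEuclidean (rootCov S k)⁻¹ (μ k)) hw hS k hℓ
    contDiffAt_const contDiffAt_const
    (exists_norm_le_mulVecEuclidean (det_inv_rootCov_ne_zero hS k))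
    (by filter_upwards [lt_mem_nhds (hw k)] with t ht x
        exact exp_log_add_gaussian hS k (μ k) x ht) rfl rfl rfl
  simp only [Function.update_eq_self] at h
  -- The weight enters only through log t, so the score is the constant 1 / w_k.
  refine ⟨_, h, (abs_integral_log_mixture_div_le hw hS k (Φ := fun _ => (w k)⁻¹)
    (B := fun l => (w k)⁻¹ * (2 / (1 - s) ^ ((m : ℝ) / 4) * decay s μ S k l))
    (fun x => ?_) (fun l => ?_)).trans_eq ?_⟩
  · simp [hℓ', abs_of_pos (hw k)]
  · obtain ⟨h1, h2⟩ := integral_prod_pow_mul_sqrt_gaussianDensity_le (μ := μ) hS hs k l (fun _ => 0)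
    simp only [pow_zero, Finset.prod_const_one, one_mul, mul_zero, Nat.zero_sub,
      Nat.doubleFactorial, Nat.cast_one, Real.sqrt_one, mul_one, Nat.cast_zero,
      Finset.sum_const_zero, add_zero] at h1 h2
    refine ⟨h1.const_mul _, ?_⟩
    rw [integral_const_mul]
    exact mul_le_mul_of_nonneg_left h2 (inv_pos.2 (hw k)).le
  · rw [Finset.mul_sum]
    refine Finset.sum_congr rfl fun l _ => ?_
    have h3 : √(w k * w l) * (w k)⁻¹ = √(w l / w k) := by
      rw [Real.sqrt_mul (hw k).le, Real.sqrt_div (hw l).le]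
      have h4 := Real.mul_self_sqrt (hw k).le
      have h5 : √(w k) ≠ 0 := (Real.sqrt_pos.2 (hw k)).ne'
      have h6 := (hw k).ne'
      rw [← div_eq_mul_inv, div_eq_div_iff h6 h5]
      linear_combination √(w l) * h4
    rw [← h3]
    ring

theorem integral_abs_coord_mul_sqrt_le (hS : ∀ k, (S k).PosDef) {s : ℝ}
    (hs : s ∈ Set.Ioo (0 : ℝ) 1) (k l : Fin K) (j : Fin m) :
    Integrable (fun x => |((rootCov S k)⁻¹ *ᵥ (x - μ k)) j| *
      √(gaussianDensity (μ k) (S k) x * gaussianDensity (μ l) (S l) x)) ∧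
    ∫ x, |((rootCov S k)⁻¹ *ᵥ (x - μ k)) j| *
      √(gaussianDensity (μ k) (S k) x * gaussianDensity (μ l) (S l) x) ≤
      2 / (1 - s) ^ (((m : ℝ) + 2) / 4) * decay s μ S k l := by
  have h := integral_prod_pow_mul_sqrt_gaussianDensity_le (μ := μ) hS hs k l (Pi.single j 1)
  have h1 : ∀ y : Fin m → ℝ, ∏ i, |y i| ^ (Pi.single j 1 : Fin m → ℕ) i = |y j| := by
    intro y
    rw [Finset.prod_eq_single j]
    · simp
    · intro i _ hi
      simp [hi]
    · simp
  have h2 : ∏ i, ((2 * (Pi.single j 1 : Fin m → ℕ) i - 1).doubleFactorial : ℝ) = 1 := by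
    refine Finset.prod_eq_one fun i _ => ?_
    by_cases hi : i = j
    · subst hi
      simp
    · simp [hi]
  have h3 : ∑ i, ((Pi.single j 1 : Fin m → ℕ) i : ℝ) = 1 := by
    rw [← Nat.cast_sum]
    simp
  simpa only [h1, h2, h3, Real.sqrt_one, mul_one] using h

theorem integral_abs_coord_mul_coord_mul_sqrt_le (hS : ∀ k, (S k).PosDef) {s : ℝ}
    (hs : s ∈ Set.Ioo (0 : ℝ) 1) (k l : Fin K) (j q : Fin m) :
    Integrable (fun x => |((rootCov S k)⁻¹ *ᵥ (x - μ k)) j| *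
      |((rootCov S k)⁻¹ *ᵥ (x - μ k)) q| *
      √(gaussianDensity (μ k) (S k) x * gaussianDensity (μ l) (S l) x)) ∧
    ∫ x, |((rootCov S k)⁻¹ *ᵥ (x - μ k)) j| * |((rootCov S k)⁻¹ *ᵥ (x - μ k)) q| *
      √(gaussianDensity (μ k) (S k) x * gaussianDensity (μ l) (S l) x) ≤
      4 / (1 - s) ^ (((m : ℝ) + 4) / 4) * decay s μ S k l := by
  obtain ⟨h, h'⟩ := integral_prod_pow_mul_sqrt_gaussianDensity_le (μ := μ) hS hs k l
    (Pi.single j 1 + Pi.single q 1)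
  have h0 : ∀ (y : Fin m → ℝ) (j : Fin m), ∏ i, |y i| ^ (Pi.single j 1 : Fin m → ℕ) i = |y j| := by
    intro y j
    rw [Finset.prod_eq_single j]
    · simp
    · intro i _ hi
      simp [hi]
    · simp
  have h1 : ∀ y : Fin m → ℝ,
      ∏ i, |y i| ^ (Pi.single j 1 + Pi.single q 1 : Fin m → ℕ) i = |y j| * |y q| := by
    intro y
    simp only [Pi.add_apply, pow_add, Finset.prod_mul_distrib, h0]
  -- The product is 3‼ = 3 if j = q and 1 otherwise; rounding up to 2² makes the square root
  -- rational.
  have h2 : ∏ i, ((2 * (Pi.single j 1 + Pi.single q 1 : Fin m → ℕ) i - 1).doubleFactorial : ℝ)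
      ≤ 2 ^ 2 := by
    rw [Finset.prod_eq_single j]
    · by_cases hj : j = q
      · subst hj
        norm_num [Nat.doubleFactorial]
      · norm_num [hj, Nat.doubleFactorial]
    · intro i _ hi
      by_cases hq : i = q
      · subst hq
        simp [hi]
      · simp [hi, hq]
    · simp
  have h3 : ∑ i, ((Pi.single j 1 + Pi.single q 1 : Fin m → ℕ) i : ℝ) = 2 := by
    rw [← Nat.cast_sum]
    simp [Finset.sum_add_distrib]
  have h4 := Real.sqrt_le_sqrt h2
  rw [Real.sqrt_sq two_pos.le] at h4
  simp only [h1] at h h'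
  refine ⟨h, h'.trans ?_⟩
  rw [h3]
  have h5 : (2 : ℝ) * 2 = 4 := by norm_num
  rw [h5]
  have h6 : 0 < (1 - s) ^ (((m : ℝ) + 4) / 4) := Real.rpow_pos_of_pos (sub_pos.2 hs.2) _
  refine mul_le_mul_of_nonneg_right (div_le_div_of_nonneg_right (by linarith) h6.le)
    (decay_pos s k l).le

theorem exists_hasDerivAt_mean (hw : ∀ k, 0 < w k) (hS : ∀ k, (S k).PosDef) {s : ℝ}
    (hs : s ∈ Set.Ioo (0 : ℝ) 1) (k : Fin K) (p : Fin m) :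
    ∃ D : ℝ, HasDerivAt (fun t => entropyError w (setMean μ k p t) S) D (μ k p) ∧
      |D| ≤ ∑ l ∈ Finset.univ.erase k, √(w k * w l) *
        ((∑ j, |(rootCov S k)⁻¹ j p|) * (2 / (1 - s) ^ (((m : ℝ) + 2) / 4) * decay s μ S k l)) := by
  have hupd : ∀ t, Function.update (μ k) p t = μ k + (t - μ k p) • Pi.single p 1 := by
    intro t
    ext j
    by_cases hj : j = p
    · subst hj
      simp
    · simp [hj]
  set L := mulVecEuclidean (rootCov S k)⁻¹ with hL
  have hb : ∀ t, L (Function.update (μ k) p t) = L (μ k) + (t - μ k p) • L (Pi.single p 1) := by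
    intro t
    rw [hupd, map_add, map_smul]
  have hcd : ContDiffAt ℝ 1 (fun t => L (Function.update (μ k) p t)) (μ k p) := by
    simp only [hb]
    fun_prop
  have hd : deriv (fun t => L (Function.update (μ k) p t)) (μ k p) = L (Pi.single p 1) := by
    simp only [hb]
    have := (((hasDerivAt_id (μ k p)).sub_const (μ k p)).smul_const (L (Pi.single p 1))).const_add
      (L (μ k))
    simpa using this.deriv
  have h := hasDerivAt_entropyError (wt := fun _ => w k)
    (μt := fun t => Function.update (μ k) p t) (St := fun _ => S k)
    (L := fun _ => L) (b := fun t => L (Function.update (μ k) p t)) hw hS k contDiffAt_const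
    contDiffAt_const hcd (exists_norm_le_mulVecEuclidean (det_inv_rootCov_ne_zero hS k))
    (Filter.Eventually.of_forall fun t x => exp_log_add_gaussian hS k _ x (hw k)) rfl
    (Function.update_eq_self _ _) rfl
  simp only [Function.update_eq_self] at h
  refine ⟨_, h, abs_integral_log_mixture_div_le hw hS k
    (Φ := fun x => ∑ j, |(rootCov S k)⁻¹ j p| * |((rootCov S k)⁻¹ *ᵥ (x - μ k)) j|)
    (fun x => ?_) (fun l => ?_)⟩
  · rw [hd]
    simp only [deriv_const', zero_apply, zero_sub, inner_neg_right, neg_neg]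
    rw [← map_sub, hL, inner_mulVecEuclidean_single]
    refine (Finset.abs_sum_le_sum_abs _ _).trans_eq (Finset.sum_congr rfl fun j _ => abs_mul _ _)
  · simp only [Finset.sum_mul, mul_assoc]
    have h1 := fun j => integral_abs_coord_mul_sqrt_le (μ := μ) hS hs k l j
    refine ⟨integrable_finsetSum _ fun j _ => (h1 j).1.const_mul _, ?_⟩
    rw [integral_finsetSum]
    swap
    · exact fun j _ => (h1 j).1.const_mul _
    refine Finset.sum_le_sum fun j _ => ?_
    rw [integral_const_mul]
    exact mul_le_mul_of_nonneg_left (h1 j).2 (abs_nonneg _)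

/-- With C = Γ_k⁻¹ and y the whitened variable, the score is −C_{qp} + y_q ∑_j C_{jp} y_j: the first
term comes from the log determinant, the second from differentiating the inverse root. The
coefficients 2 and 4 are the moment constants of degrees 0 and 2. -/
theorem exists_hasDerivAt_rootEntry (hw : ∀ k, 0 < w k) (hS : ∀ k, (S k).PosDef) {s : ℝ}
    (hs : s ∈ Set.Ioo (0 : ℝ) 1) (k : Fin K) (p q : Fin m) :
    ∃ D : ℝ, HasDerivAt (fun t => entropyError w μ (setRootEntry S k p q t)) D
        (rootCov S k p q) ∧
      |D| ≤ ∑ l ∈ Finset.univ.erase k, √(w k * w l) *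
        ((2 * |(rootCov S k)⁻¹ q p| + 4 * ∑ j, |(rootCov S k)⁻¹ j p|) *
          (1 / (1 - s) ^ (((m : ℝ) + 4) / 4) * decay s μ S k l)) := by
  set Γ := rootCov S k with hΓ
  set C := Γ⁻¹ with hC
  have hdet : 0 < Γ.det := (posDef_sqrt (hS k)).det_pos
  set c := C q p with hc
  set t₀ := Γ p q with ht₀
  have hden : HasDerivAt (fun t => 1 + (t - t₀) * c) c t₀ := by
    simpa using (((hasDerivAt_id t₀).sub_const t₀).mul_const c).const_add 1
  have hden₀ : 1 + (t₀ - t₀) * c = 1 := by simp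
  have hev : ∀ᶠ t in nhds t₀, 1 + (t - t₀) * c ≠ 0 :=
    hden.continuousAt.eventually_ne (by rw [hden₀]; exact one_ne_zero)
  set u : ℝ → ℝ := fun t => (t - t₀) / (1 + (t - t₀) * c) with hu
  have hucd : ContDiffAt ℝ 1 u t₀ :=
    ContDiffAt.div (by fun_prop) (by fun_prop) (by rw [hden₀]; exact one_ne_zero)
  have hud : HasDerivAt u 1 t₀ := by
    have := ((hasDerivAt_id t₀).sub_const t₀).fun_div hden (by rw [hden₀]; exact one_ne_zero)
    simpa using this
  set κ : ℝ := Real.log (w k) - (m : ℝ) / 2 * Real.log (2 * Real.pi) with hκ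
  set ℓ : ℝ → ℝ := fun t => κ - Real.log (Γ.det * (1 + (t - t₀) * c)) with hℓ
  have hne : Γ.det * (1 + (t₀ - t₀) * c) ≠ 0 := by
    rw [hden₀, mul_one]
    exact hdet.ne'
  have hℓcd : ContDiffAt ℝ 1 ℓ t₀ :=
    contDiffAt_const.sub (ContDiffAt.log (by fun_prop) hne)
  have hℓd : deriv ℓ t₀ = -c := by
    have := ((hden.const_mul Γ.det).log hne).const_sub κ
    rw [hden₀, mul_one, mul_div_cancel_left₀ _ hdet.ne'] at this
    exact this.deriv
  set M := mulVecEuclidean (C * Matrix.single p q 1 * C) with hM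
  -- The Sherman–Morrison expression replaces the inverse, making smoothness in t evident; the two
  -- agree where the denominator is nonzero, hence near `t₀`.
  set L : ℝ → (Fin m → ℝ) →L[ℝ] EuclideanSpace ℝ (Fin m) :=
    fun t => mulVecEuclidean C - u t • M with hL
  have hLcd : ContDiffAt ℝ 1 L t₀ := contDiffAt_const.sub (hucd.smul contDiffAt_const)
  have hLd : HasDerivAt L (-M) t₀ := by
    simpa using (hud.smul_const M).const_sub (mulVecEuclidean C)
  have hL₀ : L t₀ = mulVecEuclidean C := by
    have hu₀ : u t₀ = 0 := by simp [hu]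
    ext x : 1
    change mulVecEuclidean C x - u t₀ • M x = _
    rw [hu₀, zero_smul, sub_zero]
  have hLt : ∀ t, 1 + (t - t₀) * c ≠ 0 → L t = mulVecEuclidean (setEntry Γ p q t)⁻¹ := by
    intro t ht
    rw [inv_setEntry hdet.ne' p q ht, mulVecEuclidean_sub_smul]
  have hbcd : ContDiffAt ℝ 1 (fun t => L t (μ k)) t₀ := hLcd.clm_apply contDiffAt_const
  have hbd : HasDerivAt (fun t => L t (μ k)) (-M (μ k)) t₀ := by
    simpa using hLd.clm_apply (hasDerivAt_const t₀ (μ k))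
  have hS₀ : setEntry Γ p q t₀ * (setEntry Γ p q t₀)ᵀ = S k := by
    rw [setEntry_eq, sub_self, zero_smul, add_zero]
    exact sqrt_mul_transpose (hS k)
  have h := hasDerivAt_entropyError (wt := fun _ => w k) (μt := fun _ => μ k)
    (St := fun t => setEntry Γ p q t * (setEntry Γ p q t)ᵀ) (ℓ := ℓ) (L := L)
    (b := fun t => L t (μ k)) hw hS k hℓcd hLcd hbcd
    (by rw [hL₀]; exact exists_norm_le_mulVecEuclidean (det_inv_rootCov_ne_zero hS k))
    (by
      filter_upwards [hev] with t ht x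
      have hdt : (setEntry Γ p q t).det ≠ 0 := by
        rw [det_setEntry hdet.ne']
        exact mul_ne_zero hdet.ne' ht
      rw [gaussianDensity_mul_transpose hdt, det_setEntry hdet.ne', ← hLt t ht, ← map_sub]
      nth_rewrite 1 [← Real.exp_log (hw k)]
      rw [← Real.exp_add]
      congr 1
      simp only [hℓ, hκ]
      ring) rfl rfl hS₀
  simp only [Function.update_eq_self] at h
  set Y : (Fin m → ℝ) → Fin m → ℝ := fun x => C *ᵥ (x - μ k) with hY
  refine ⟨_, h, abs_integral_log_mixture_div_le hw hS k
    (Φ := fun x => |c| + ∑ j, |C j p| * (|Y x j| * |Y x q|))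
    (fun x => ?_) (fun l => ?_)⟩
  -- The rank-one matrix C E C sends x − μ_k to y_q C e_p, which makes the score quadratic in y.
  · have h1 : M (x - μ k) = Y x q • mulVecEuclidean C (Pi.single p 1) := by
      rw [hM, ← map_smul, mulVecEuclidean_apply, mulVecEuclidean_apply, mul_assoc,
        ← Matrix.mulVec_mulVec, ← Matrix.mulVec_mulVec, Matrix.single_mulVec]
      congr 2
      ext i
      by_cases hi : i = p
      · subst hi
        simp [hY]
      · simp [hi]
    have hneg : -M x - -M (μ k) = -M (x - μ k) := by
      rw [map_sub]
      abel
    have h2 : deriv ℓ t₀ - inner ℝ (L t₀ x - L t₀ (μ k)) (deriv L t₀ x - deriv (fun t => L t (μ k)) t₀)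
        = -c + ∑ j, C j p * (Y x j * Y x q) := by
      rw [hℓd, hLd.deriv, hbd.deriv, hL₀, ← map_sub, neg_apply,
        hneg, h1, inner_neg_right, inner_smul_right,
        inner_mulVecEuclidean_single, Finset.mul_sum, sub_neg_eq_add]
      congr 1
      refine Finset.sum_congr rfl fun j _ => ?_
      simp only [hY]
      ring
    rw [h2]
    refine (abs_add_le _ _).trans ?_
    rw [abs_neg]
    refine add_le_add le_rfl ((Finset.abs_sum_le_sum_abs _ _).trans_eq
      (Finset.sum_congr rfl fun j _ => by rw [abs_mul, abs_mul]))
  · have h1 := fun j => integral_abs_coord_mul_coord_mul_sqrt_le (μ := μ) hS hs k l j q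
    obtain ⟨h2, h3⟩ :=
      integral_prod_pow_mul_sqrt_gaussianDensity_le (μ := μ) hS hs k l (fun _ => 0)
    simp only [pow_zero, Finset.prod_const_one, one_mul, mul_zero, Nat.zero_sub,
      Nat.doubleFactorial, Nat.cast_one, Real.sqrt_one, mul_one, Nat.cast_zero,
      Finset.sum_const_zero, add_zero] at h2 h3
    simp only [add_mul |c|, Finset.sum_mul, mul_assoc |C _ p|]
    have h4 : ∀ j, Integrable (fun x => |C j p| * (|Y x j| * |Y x q| *
      √(gaussianDensity (μ k) (S k) x * gaussianDensity (μ l) (S l) x))) :=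
      fun j => (h1 j).1.const_mul _
    have h5 := integrable_finsetSum Finset.univ (fun j _ => h4 j)
    refine ⟨(h2.const_mul |c|).add h5, ?_⟩
    rw [integral_add (h2.const_mul |c|) h5, integral_finsetSum _ (fun j _ => h4 j)]
    simp only [integral_const_mul]
    have hr : 0 < 1 - s := sub_pos.2 hs.2
    -- Since 0 < 1 − s < 1, the degree-0 moment can be put over the larger power belonging to degree
    -- 2.
    have h6 : 2 / (1 - s) ^ ((m : ℝ) / 4) * decay s μ S k l ≤
        2 * (1 / (1 - s) ^ (((m : ℝ) + 4) / 4) * decay s μ S k l) := by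
      rw [← mul_assoc, mul_one_div]
      refine mul_le_mul_of_nonneg_right ?_ (decay_pos s k l).le
      refine div_le_div_of_nonneg_left two_pos.le (Real.rpow_pos_of_pos hr _) ?_
      exact Real.rpow_le_rpow_of_exponent_ge hr (by linarith [hs.1]) (by linarith)
    have h7 : ∀ j, |C j p| * ∫ x, |Y x j| * |Y x q| *
        √(gaussianDensity (μ k) (S k) x * gaussianDensity (μ l) (S l) x) ≤
        |C j p| * (4 * (1 / (1 - s) ^ (((m : ℝ) + 4) / 4) * decay s μ S k l)) := fun j => by
      refine mul_le_mul_of_nonneg_left ((h1 j).2.trans_eq ?_) (abs_nonneg _)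
      ring
    have h8 := Finset.sum_le_sum (fun j (_ : j ∈ Finset.univ) => h7 j)
    rw [← Finset.sum_mul] at h8
    have h9 := mul_le_mul_of_nonneg_left (h3.trans h6) (abs_nonneg c)
    refine (add_le_add h9 h8).trans_eq ?_
    ring

end

end GaussianMixture

/-! ### Comparison with the stated constants -/

theorem theorem4p3 {K m : ℕ} (w : Fin K → ℝ) (μ : Fin K → Fin m → ℝ)
    (S : Fin K → Matrix (Fin m) (Fin m) ℝ)
    (hw : ∀ k, 0 < w k) (hsum : ∑ k, w k = 1) (hS : ∀ k, (S k).PosDef)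
    (s : ℝ) (hs : s ∈ Set.Ioo (0 : ℝ) 1) (k : Fin K) :
    (∀ p : Fin m, ∃ D : ℝ,
      HasDerivAt (fun t => GaussianMixture.entropyError w (GaussianMixture.setMean μ k p t) S)
        D (μ k p) ∧
      |D| ≤ 2 / (1 - s) ^ (((m : ℝ) + 2) / 4) *
        ∑ l ∈ Finset.univ.erase k, √(w k * w l) *
          (GaussianMixture.entryNorm (GaussianMixture.rootCov S l)⁻¹ +
            GaussianMixture.entryNorm (GaussianMixture.rootCov S k)⁻¹) *
          GaussianMixture.decay s μ S k l) ∧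
    (∀ p q : Fin m, ∃ D : ℝ,
      HasDerivAt
        (fun t => GaussianMixture.entropyError w μ (GaussianMixture.setRootEntry S k p q t))
        D (GaussianMixture.rootCov S k p q) ∧
      |D| ≤ 6 / (1 - s) ^ (((m : ℝ) + 4) / 4) *
        ∑ l ∈ Finset.univ.erase k, √(w k * w l) *
          (2 * ((GaussianMixture.rootCov S k).det)⁻¹ *
              GaussianMixture.minorDet (GaussianMixture.rootCov S k) p q +
            GaussianMixture.entryNorm (GaussianMixture.rootCov S k)⁻¹ +
            GaussianMixture.entryNorm (GaussianMixture.rootCov S l)⁻¹) *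
          GaussianMixture.decay s μ S k l) ∧
    (∃ D : ℝ,
      HasDerivAt (fun t => GaussianMixture.entropyError (Function.update w k t) μ S) D (w k) ∧
      |D| ≤ 8 / (1 - s) ^ ((m : ℝ) / 4) *
        ∑ l ∈ Finset.univ.erase k, √(w l / w k) * GaussianMixture.decay s μ S k l) := by
  have hr : 0 < 1 - s := sub_pos.2 hs.2
  refine ⟨fun p => ?_, fun p q => ?_, ?_⟩
  · obtain ⟨D, hD, hb⟩ := GaussianMixture.exists_hasDerivAt_mean (μ := μ) hw hS hs k p
    refine ⟨D, hD, hb.trans ?_⟩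
    rw [Finset.mul_sum]
    refine Finset.sum_le_sum fun l _ => ?_
    have h1 : ∑ j, |(GaussianMixture.rootCov S k)⁻¹ j p| ≤
        GaussianMixture.entryNorm (GaussianMixture.rootCov S l)⁻¹ +
          GaussianMixture.entryNorm (GaussianMixture.rootCov S k)⁻¹ := by
      have h2 := GaussianMixture.entryNorm_nonneg (GaussianMixture.rootCov S l)⁻¹
      have h3 := GaussianMixture.sum_abs_row_le_entryNorm (GaussianMixture.rootCov S k)⁻¹ p
      -- Symmetry of Γ_k⁻¹ turns the column sum from the score into a row sum.
      simp only [GaussianMixture.apply_comm_of_posDef (GaussianMixture.posDef_inv_sqrt (hS k)) p,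
        GaussianMixture.rootCov] at h3 ⊢
      exact h3.trans (le_add_of_nonneg_left h2)
    have h4 : 0 ≤ √(w k * w l) * (2 / (1 - s) ^ (((m : ℝ) + 2) / 4) *
        GaussianMixture.decay s μ S k l) := by
      have := (GaussianMixture.decay_pos (μ := μ) (S := S) s k l).le
      have := (Real.rpow_pos_of_pos hr (((m : ℝ) + 2) / 4)).le
      positivity
    have h5 := mul_le_mul_of_nonneg_left h1 h4
    refine (le_of_eq ?_).trans (h5.trans_eq ?_) <;> ring
  · obtain ⟨D, hD, hb⟩ := GaussianMixture.exists_hasDerivAt_rootEntry (μ := μ) hw hS hs k p q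
    refine ⟨D, hD, hb.trans ?_⟩
    rw [Finset.mul_sum (Finset.univ.erase k)]
    refine Finset.sum_le_sum fun l _ => ?_
    have h1 : 2 * |(GaussianMixture.rootCov S k)⁻¹ q p| +
        4 * ∑ j, |(GaussianMixture.rootCov S k)⁻¹ j p| ≤
        6 * (2 * ((GaussianMixture.rootCov S k).det)⁻¹ *
            GaussianMixture.minorDet (GaussianMixture.rootCov S k) p q +
          GaussianMixture.entryNorm (GaussianMixture.rootCov S k)⁻¹ +
          GaussianMixture.entryNorm (GaussianMixture.rootCov S l)⁻¹) := by
      have h2 := GaussianMixture.entryNorm_nonneg (GaussianMixture.rootCov S l)⁻¹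
      have h3 := GaussianMixture.minor_bound (GaussianMixture.posDef_sqrt (hS k)) p q
      simp only [GaussianMixture.rootCov] at h2 ⊢
      linarith
    have h4 : 0 ≤ √(w k * w l) * (1 / (1 - s) ^ (((m : ℝ) + 4) / 4) *
        GaussianMixture.decay s μ S k l) := by
      have := (GaussianMixture.decay_pos (μ := μ) (S := S) s k l).le
      have := (Real.rpow_pos_of_pos hr (((m : ℝ) + 4) / 4)).le
      positivity
    have h5 := mul_le_mul_of_nonneg_left h1 h4
    refine (le_of_eq ?_).trans (h5.trans_eq ?_) <;> ring
  · obtain ⟨D, hD, hb⟩ := GaussianMixture.exists_hasDerivAt_weight (μ := μ) hw hS hs k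
    refine ⟨D, hD, hb.trans ?_⟩
    have h1 : 0 ≤ ∑ l ∈ Finset.univ.erase k, √(w l / w k) * GaussianMixture.decay s μ S k l :=
      Finset.sum_nonneg fun l _ =>
        mul_nonneg (Real.sqrt_nonneg _) (GaussianMixture.decay_pos s k l).le
    refine mul_le_mul_of_nonneg_right ?_ h1
    exact div_le_div_of_nonneg_right (by norm_num : (2 : ℝ) ≤ 8) (Real.rpow_pos_of_pos hr _).le
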